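/- **Setting.** For each $i\ge 1$ let $b_i,h_i>0$, $\sigma_{p,i},\sigma_{f,i}>0$ be known and $\theta_i\in\mathbb R$ unknown. For each $n$ one observes $X=(X_1,\dots,X_n)\sim N(\theta,\mathrm{diag}(\sigma_{p,1},\dots,\sigma_{p,n}))$ (the $\sigma$'s are variances). Write $\tilde b_i=b_i/(b_i+h_i)$; $\phi,\Phi$ for the standard normal density and distribution function; $G(w,\beta)=\phi(w)+w\Phi(w)-\beta w$; $H_k$ for the probabilists' Hermite polynomials; $a_n=\log\log n$. For $\tau\in[0,\infty]$ let $\alpha_i(\tau)=\tau/(\tau+\sigma_{p,i})$ (with $\alpha_i(\infty)=1$) and let $\hat q(\tau)$ be the predictor with coordinates $$\hat q_i(\tau)=\alpha_i(\tau)X_i+\sqrt{\sigma_{f,i}+\alpha_i(\tau)\sigma_{p,i}}\;\Phi^{-1}(\tilde b_i).$$ The loss of $\hat q$ given $X$ is $L_n(\theta,\hat q)=\frac1n\sum_{i=1}^n \mathbb E_{Y_i\sim N(\theta_i,\sigma_{f,i})}\big[b_i(Y_i-\hat q_i)^++h_i(\hat q_i-Y_i)^+\big]$, and its risk is $R_n(\theta,\hat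 q)=\mathbb E_X[L_n(\theta,\hat q)]$. **Assumptions.** - A1: $0<\inf_i\tilde b_i\le\sup_i\tilde b_i<1$ and $\sup_i(b_i+h_i)<\infty$. - A2: $\limsup_n\frac1n\sum_{i=1}^n|\theta_i|<\infty$. - A3: $\sup_i\sigma_{p,i}/\sigma_{f,i}<1/(4e)$, $\sup_i\sigma_{f,i}<\infty$ and $\inf_i\sigma_{p,i}>0$. **Risk estimate.** Fix $\gamma_i$ with $\inf_i\gamma_i>0$ and $\gamma_i<\frac1{\sqrt{4e}}-\sqrt{\sigma_{p,i}/\sigma_{f,i}}$ for all $i$, and put $\lambda_n(i)=\gamma_i\sqrt{2\log n}$, $K_n(i)=1+\big\lceil e^2\big(\gamma_i+\sqrt{2\sigma_{p,i}/\sigma_{f,i}}\big)^2\,2\log n\big\rceil$, $$c_i(\tau)=\sqrt{\tfrac{\sigma_{f,i}+\alpha_i(\tau)\sigma_{p,i}}{\sigma_{f,i}+\alpha_i(\tau)^2\sigma_{p,i}}}\,\Phi^{-1}(\tilde b_i),\qquad d_i(\tau)=-\frac{1-\alpha_i(\tau)}{\sqrt{\sigma_{f,i}+\alpha_i(\tau)^2\sigma_{p,i}}},\qquad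 v_i(\tau)=2\sigma_{p,i}d_i(\tau)^2 .$$ For independent $Z_i\sim N(0,1)$, independent of $X$, let $U_i(\tau)=c_i(\tau)+d_i(\tau)(X_i+\sqrt{\sigma_{p,i}}Z_i)$ and $V_i(\tau)=c_i(\tau)+d_i(\tau)(X_i-\sqrt{\sigma_{p,i}}Z_i)$. Let $$S_i(u)=G(0,\tilde b_i)+G'(0,\tilde b_i)\,u+\phi(0)\sum_{k=0}^{K_n(i)-2}\frac{(-1)^kH_k(0)}{(k+2)!}\,v_i(\tau)^{(k+2)/2}H_{k+2}\!\Big(\frac{u}{\sqrt{v_i(\tau)}}\Big),$$ where $G'$ is the derivative in the first argument and $v^{k/2}H_k(u/\sqrt v)$ means $u^k$ when $v=0$, and let $\tilde S_i=\operatorname{sign}(S_i)\min\{|S_i|,n\}$. Let $\hat T_i(X_i,Z_i,\tau)$ equal $-\tilde b_iU_i(\tau)$ if $V_i(\tau)<-\lambda_n(i)$, $\tilde S_i(U_i(\tau))$ if $|V_i(\tau)|\le\lambda_n(i)$, and $(1-\tilde b_i)U_i(\tau)$ if $V_i(\tau)>\lambda_n(i)$; let $\hat T_i(X_i,\tau)=\mathbb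 E[\hat T_i(X_i,Z_i,\tau)\mid X]$ and $$\widehat{\mathrm{ARE}}_n(\tau)=\frac1n\sum_{i=1}^n(b_i+h_i)\sqrt{\sigma_{f,i}+\sigma_{p,i}\alpha_i(\tau)^2}\;\hat T_i(X_i,\tau).$$ **Grid and ARE hyperparameter.** Fix constants with $b_i+h_i\le C_1$, $\max\{\sigma_{p,i},\sigma_{p,i}^{-1}\}\le C_2$ for all $i$, $\big(\sup_i\sigma_{p,i}/\sigma_{f,i}\big)\sup_i|\Phi^{-1}(\tilde b_i)|\le C_3$, and $C_4>0$. Let $\delta_n=\{2C_1C_2(2\phi(0)+C_3+\sqrt{a_n}\,C_4+a_n)\}^{-1}$ and let $\Lambda_n\subset[0,\infty]$ be the set of $\tau$ for which $\tau/(\tau+1)\in\{(j-1)\delta_n:1\le j\le\lceil1/\delta_n\rceil\}$. (For the finitely many $n$ with $a_n$ undefined or negative, $\sqrt{a_n}$ is read as $0$, and an undefined $a_n$ as $0$.) Let $\hat\tau^{\mathrm{ARE}}_n\in\arg\min_{\tau\in\Lambda_n}\widehat{\mathrm{ARE}}_n(\tau)$ be any measurable choice of minimizer. **Statement.** Under A1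 and A3, for every $\theta$ satisfying A2, every $\epsilon>0$ and every sequence of estimators $\hat\tau_n=\hat\tau_n(X)\in[0,\infty]$ (measurable functions of $X$): I. $\displaystyle\lim_{n\to\infty}\Pr\big\{L_n(\theta,\hat q(\hat\tau^{\mathrm{ARE}}_n))\ge L_n(\theta,\hat q(\hat\tau_n))+\epsilon\big\}=0$; II. the risks $R_n(\theta,\hat q(\hat\tau^{\mathrm{ARE}}_n))$ and $R_n(\theta,\hat q(\hat\tau_n))$ are finite and $\displaystyle\limsup_{n\to\infty}\big[R_n(\theta,\hat q(\hat\tau^{\mathrm{ARE}}_n))-R_n(\theta,\hat q(\hat\tau_n))\big]\le0$. -/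

import Mathlib

open MeasureTheory ProbabilityTheory Filter Topology
open scoped NNReal ENNReal

namespace CheckLoss

noncomputable section

/-- The known constants of one coordinate: underestimation weight `b`, overestimation weight `h`,
variance `σp` of the past observation and variance `σf` of the future observation. -/
structure Coord where
  b : ℝ
  h : ℝ
  σp : ℝ≥0
  σf : ℝ≥0

/-- Standard normal density. -/
def stdPdf (w : ℝ) : ℝ := gaussianPDFReal 0 1 w

/-- Standard normal distribution function. -/
def stdCdf (w : ℝ) : ℝ := cdf (gaussianReal 0 1) w

/-- Standard normal quantile function, the inverse of `stdCdf` on `(0, 1)`. -/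
def stdQuantile (β : ℝ) : ℝ := sInf {w : ℝ | β ≤ stdCdf w}

/-- `G(w, β) = φ(w) + w Φ(w) - β w`. -/
def G (w β : ℝ) : ℝ := stdPdf w + w * stdCdf w - β * w

namespace Coord

variable (P : Coord)

/-- The critical ratio `b / (b + h)`. -/
def ratio : ℝ := P.b / (P.b + P.h)

/-- The shrinkage factor `τ / (τ + σp)` for `τ ∈ [0, ∞]`, equal to `1` at `τ = ∞`. -/
def alpha (τ : ℝ≥0∞) : ℝ := if τ = ∞ then 1 else τ.toReal / (τ.toReal + P.σp)

/-- The coordinate predictor with hyperparameter `τ`, at the observation `x`. -/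
def qhat (τ : ℝ≥0∞) (x : ℝ) : ℝ :=
  P.alpha τ * x + √(P.σf + P.alpha τ * P.σp) * stdQuantile P.ratio

/-- The predictive check loss of the prediction `q`: the expectation over the future
observation `Y ∼ N(θ, σf)`. -/
def loss (θ q : ℝ) : ℝ :=
  ∫ y, (P.b * max (y - q) 0 + P.h * max (q - y) 0) ∂(gaussianReal θ P.σf)

def c (τ : ℝ≥0∞) : ℝ :=
  √((P.σf + P.alpha τ * P.σp) / (P.σf + P.alpha τ ^ 2 * P.σp)) * stdQuantile P.ratio

def d (τ : ℝ≥0∞) : ℝ := -(1 - P.alpha τ) / √(P.σf + P.alpha τ ^ 2 * P.σp)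

end Coord

/-- The value at `0` of the probabilists' Hermite polynomial `H_k`. -/
def hermiteZero (k : ℕ) : ℝ := Polynomial.aeval (0 : ℝ) (Polynomial.hermite k)

/-- `v^{k/2} H_k(u / √v)`, with its limiting value `u^k` when `v = 0`. -/
def scaledHermite (k : ℕ) (v u : ℝ) : ℝ :=
  if v = 0 then u ^ k else √v ^ k * Polynomial.aeval (u / √v) (Polynomial.hermite k)

/-- Threshold `λ_n = γ √(2 log n)`. -/
def threshold (γ : ℝ) (n : ℕ) : ℝ := γ * √(2 * Real.log n)

namespace Coord

variable (P : Coord)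

/-- Truncation order `K_n = 1 + ⌈e² (γ + √(2 σp/σf))² (2 log n)⌉`. -/
def order (γ : ℝ) (n : ℕ) : ℕ :=
  1 + ⌈Real.exp 1 ^ 2 * (γ + √(2 * (P.σp / P.σf))) ^ 2 * (2 * Real.log n)⌉₊

/-- Unbiased estimate of the Taylor polynomial of order `K_n` of `G`. -/
def S (γ : ℝ) (n : ℕ) (τ : ℝ≥0∞) (u : ℝ) : ℝ :=
  G 0 P.ratio + deriv (fun w => G w P.ratio) 0 * u
    + stdPdf 0 * ∑ k ∈ Finset.range (P.order γ n - 1),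
        (-1) ^ k * hermiteZero k / (Nat.factorial (k + 2) : ℝ)
          * scaledHermite (k + 2) (2 * P.σp * P.d τ ^ 2) u

/-- `S` truncated to `[-n, n]`. -/
def Stilde (γ : ℝ) (n : ℕ) (τ : ℝ≥0∞) (u : ℝ) : ℝ :=
  Real.sign (P.S γ n τ u) * min |P.S γ n τ u| n

/-- The randomized coordinatewise threshold estimate, at the observation `x` and the added
noise `z`. -/
def Trand (γ : ℝ) (n : ℕ) (τ : ℝ≥0∞) (x z : ℝ) : ℝ :=
  let u := P.c τ + P.d τ * (x + √P.σp * z)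
  let v := P.c τ + P.d τ * (x - √P.σp * z)
  if v < -threshold γ n then -P.ratio * u
  else if v ≤ threshold γ n then P.Stilde γ n τ u
  else (1 - P.ratio) * u

/-- The coordinatewise estimate after averaging over the noise `Z ∼ N(0, 1)`. -/
def T (γ : ℝ) (n : ℕ) (τ : ℝ≥0∞) (x : ℝ) : ℝ :=
  ∫ z, P.Trand γ n τ x z ∂(gaussianReal 0 1)

end Coord

/-- The law `N(θ, Σ_p)` of the first `n` past observations. -/
def dataLaw (P : ℕ → Coord) (θ : ℕ → ℝ) (n : ℕ) : Measure (Fin n → ℝ) :=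
  Measure.pi fun i => gaussianReal (θ i) (P i).σp

/-- The predictive loss `L_n(θ, q̂(τ))` at the observation `x`. -/
def avgLoss (P : ℕ → Coord) (θ : ℕ → ℝ) (n : ℕ) (τ : ℝ≥0∞) (x : Fin n → ℝ) : ℝ :=
  (1 / n) * ∑ i : Fin n, (P i).loss (θ i) ((P i).qhat τ (x i))

/-- The predictive risk `R_n(θ, q̂(τ̂))` for a data-dependent hyperparameter `τ̂`. -/
def risk (P : ℕ → Coord) (θ : ℕ → ℝ) (n : ℕ) (τhat : (Fin n → ℝ) → ℝ≥0∞) : ℝ :=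
  ∫ x, avgLoss P θ n (τhat x) x ∂(dataLaw P θ n)

/-- The asymptotic risk estimate of `τ` at the observation `x`. -/
def ARE (P : ℕ → Coord) (γ : ℕ → ℝ) (n : ℕ) (τ : ℝ≥0∞) (x : Fin n → ℝ) : ℝ :=
  (1 / n) * ∑ i : Fin n, ((P i).b + (P i).h)
    * √((P i).σf + (P i).σp * (P i).alpha τ ^ 2) * (P i).T (γ i) n τ (x i)

/-- Grid spacing on the scale `τ / (τ + 1)`. -/
def gridStep (C₁ C₂ C₃ C₄ : ℝ) (n : ℕ) : ℝ :=
  (2 * C₁ * C₂ * (2 * stdPdf 0 + C₃ + √(Real.log (Real.log n)) * C₄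
    + Real.log (Real.log n)))⁻¹

/-- The grid `Λ_n`: the points `τ ∈ [0, ∞]` for which `τ / (τ + 1)` is one of the `⌈1/δ⌉`
equispaced values `0, δ, 2δ, …` in `[0, 1]`. -/
def grid (C₁ C₂ C₃ C₄ : ℝ) (n : ℕ) : Set ℝ≥0∞ :=
  {τ | ∃ j : ℕ, j < ⌈1 / gridStep C₁ C₂ C₃ C₄ n⌉₊ ∧
    τ = ENNReal.ofReal (j * gridStep C₁ C₂ C₃ C₄ n)
      / ENNReal.ofReal (1 - j * gridStep C₁ C₂ C₃ C₄ n)}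

/-- `τhat` is a minimizer of the risk estimate over the set `Λ n`, for every dimension and every
observation. -/
def IsAREMinimizer (P : ℕ → Coord) (γ : ℕ → ℝ) (Λ : ℕ → Set ℝ≥0∞)
    (τhat : (n : ℕ) → (Fin n → ℝ) → ℝ≥0∞) : Prop :=
  ∀ n x, τhat n x ∈ Λ n ∧ ∀ τ ∈ Λ n, ARE P γ n (τhat n x) x ≤ ARE P γ n τ x

/-- Positive weights, critical ratios bounded away from `0` and `1`, bounded total weights. -/
def BoundedWeights (P : ℕ → Coord) : Prop :=
  (∀ i, 0 < (P i).b ∧ 0 < (P i).h) ∧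
  (∃ lo > 0, ∀ i, lo ≤ (P i).ratio) ∧ (∃ hi < 1, ∀ i, (P i).ratio ≤ hi) ∧
  ∃ B, ∀ i, (P i).b + (P i).h ≤ B

/-- `limsup_n (1/n) ∑_{i ≤ n} |θ_i| < ∞`. -/
def BoundedMeans (θ : ℕ → ℝ) : Prop :=
  IsBoundedUnder (· ≤ ·) atTop fun n : ℕ => (1 / (n : ℝ)) * ∑ i ∈ Finset.range n, |θ i|

/-- `sup_i σp_i / σf_i < 1 / (4e)`, with the future variances positive and bounded above and the
past variances bounded away from `0`. -/
def SufficientHistory (P : ℕ → Coord) : Prop :=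
  (∀ i, 0 < (P i).σf) ∧
  (∃ ρ < 1 / (4 * Real.exp 1), ∀ i, ((P i).σp : ℝ) / (P i).σf ≤ ρ) ∧
  (∃ B : ℝ, ∀ i, ((P i).σf : ℝ) ≤ B) ∧ ∃ lo > (0 : ℝ), ∀ i, lo ≤ (P i).σp

/-- Threshold multipliers: `γ_i < 1/√(4e) - √(σp_i/σf_i)`, and `γ_i` is bounded away from `0`. -/
def AdmissibleThresholds (P : ℕ → Coord) (γ : ℕ → ℝ) : Prop :=
  (∃ γ₀ > 0, ∀ i, γ₀ ≤ γ i) ∧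
  ∀ i, γ i < 1 / √(4 * Real.exp 1) - √((P i).σp / (P i).σf)

/-- The constants from which the grid spacing is built. -/
def GridConstants (P : ℕ → Coord) (C₁ C₂ C₃ C₄ : ℝ) : Prop :=
  (∀ i, (P i).b + (P i).h ≤ C₁) ∧
  (∀ i, ((P i).σp : ℝ) ≤ C₂ ∧ ((P i).σp : ℝ)⁻¹ ≤ C₂) ∧
  (∀ i j, ((P i).σp : ℝ) / (P i).σf * |stdQuantile (P j).ratio| ≤ C₃) ∧
  0 < C₄

end

end CheckLoss

namespace CheckLoss

noncomputable section

/-! ### The standard normal density and distribution function -/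

/-! The proof compares an estimated risk curve with the realized loss, uniformly over a small grid.
Under `N(θ, σp)` the expected loss of one coordinate is `(b + h) √(σf + σp α²) G(c + d θ, b/(b+h))`
(`integral_loss_qhat`), so it suffices to estimate `G` at the unknown mean `μ = c + d θ`. Adding and
subtracting independent noise splits `X` into independent `U` and `V` of mean `μ`
(`map_add_sub_gaussianReal`, `map_pair`): `V` selects a formula and `U` is put into it.

For `|V|` below the threshold the formula is the Hermite estimate of a Taylor polynomial of `G`,
unbiased before it is cut at `±n`. Let `t₀ = √(2 log n)`. If `|μ| ≤ M = (γ + r) t₀`, where `r = √(2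
σp/σf)`, degree of order `e² M²` makes the Taylor error tiny, and the history assumption keeps the
second moment at `√n` up to logarithms, so cutting costs little (`middle_branch_near`). If `|μ| >
M`, then `V` is at least `t₀` standard deviations from the middle region, which outweighs the cut
level `n` (`middle_branch_far`). For `|V|` above the threshold `G` is replaced by its asymptote,
whose error times the probability of choosing the wrong side is `O(1/t₀)` (`tail_mul_hingeMean_le`).
Hence `thresholdRule_bounds`: the bias tends to `0` and the mean squared error is `O(n / √(log n))`.

Averaging over `n` independent coordinates leaves variance `O(1/√(log n))`, while the grid has only
`O(log log n)` points; summing variances therefore controls all grid points at once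
(`exists_uniform_error`). The loss is Lipschitz in the shrinkage factors, so moving any `τ` to the
grid costs the spacing times an average of `|X_i|`. Together these give
`eventually_oracle_inequality`: a random error `E`, not depending on `τ`, with arbitrarily small
mean, by which the minimizer can lose to any `τ`. As `E` serves every `τ` at each observation,
data-dependent competitors are covered. Markov's inequality gives the claim in probability and
integration the claim on risks. -/

lemma stdPdf_eq (w : ℝ) : stdPdf w = (√(2 * Real.pi))⁻¹ * Real.exp (-w ^ 2 / 2) := by
  simp [stdPdf, gaussianPDFReal]

lemma stdPdf_pos (w : ℝ) : 0 < stdPdf w := gaussianPDFReal_pos 0 1 w one_ne_zero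

lemma stdPdf_le_exp (w : ℝ) : stdPdf w ≤ Real.exp (-w ^ 2 / 2) / 2 := by
  have h : (2 : ℝ) ≤ √(2 * Real.pi) :=
    Real.le_sqrt_of_sq_le (by nlinarith [Real.pi_gt_three])
  rw [stdPdf_eq, div_eq_inv_mul (Real.exp _)]
  exact mul_le_mul_of_nonneg_right (inv_anti₀ (by norm_num) h) (Real.exp_pos _).le

lemma stdPdf_le_half (w : ℝ) : stdPdf w ≤ 1 / 2 := by
  have := stdPdf_le_exp w
  have h : Real.exp (-w ^ 2 / 2) ≤ 1 := Real.exp_le_one_iff.2 (by nlinarith [sq_nonneg w])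
  linarith

lemma stdPdf_eq_zero_mul (w : ℝ) : stdPdf w = stdPdf 0 * Real.exp (-(w ^ 2 / 2)) := by
  simp [stdPdf_eq, neg_div]

lemma continuous_stdPdf : Continuous stdPdf := by
  have : stdPdf = fun w => (√(2 * Real.pi))⁻¹ * Real.exp (-w ^ 2 / 2) := funext stdPdf_eq
  rw [this]; fun_prop

lemma integrable_stdPdf : Integrable stdPdf := integrable_gaussianPDFReal 0 1

lemma hasDerivAt_gaussianPDFReal_one (m x : ℝ) :
    HasDerivAt (gaussianPDFReal m 1) (-((x - m) * gaussianPDFReal m 1 x)) x := by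
  have h : HasDerivAt (fun x : ℝ => -(x - m) ^ 2 / 2) (-(x - m)) x := by
    have := (((hasDerivAt_id x).sub_const m).pow 2).neg.div_const 2
    refine this.congr_deriv ?_
    simp only [id]; push_cast; ring
  have h2 := h.exp.const_mul (√(2 * Real.pi))⁻¹
  have e : gaussianPDFReal m 1 = fun x => (√(2 * Real.pi))⁻¹ * Real.exp (-(x - m) ^ 2 / 2) := by
    ext; simp [gaussianPDFReal]
  rw [e]
  refine h2.congr_deriv ?_
  ring

lemma hasDerivAt_stdPdf (w : ℝ) : HasDerivAt stdPdf (-(w * stdPdf w)) w := by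
  have := hasDerivAt_gaussianPDFReal_one 0 w
  rwa [sub_zero] at this

lemma stdCdf_eq_integral (w : ℝ) : stdCdf w = ∫ x in Set.Iic w, stdPdf x := by
  rw [stdCdf, cdf_eq_real, Measure.real, gaussianReal_apply_eq_integral 0 one_ne_zero,
    ENNReal.toReal_ofReal]
  · rfl
  · exact integral_nonneg fun x => gaussianPDFReal_nonneg _ _ _

lemma stdCdf_nonneg (w : ℝ) : 0 ≤ stdCdf w := cdf_nonneg _ _

lemma stdCdf_le_one (w : ℝ) : stdCdf w ≤ 1 := cdf_le_one _ _

lemma hasDerivAt_stdCdf (w : ℝ) : HasDerivAt stdCdf (stdPdf w) w := by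
  have h := intervalIntegral.integral_hasDerivAt_right (a := 0) (b := w)
    (continuous_stdPdf.intervalIntegrable 0 w)
    (continuous_stdPdf.stronglyMeasurableAtFilter _ _) continuous_stdPdf.continuousAt
  refine (h.const_add (stdCdf 0)).congr_of_eventuallyEq (Eventually.of_forall fun x => ?_)
  have := intervalIntegral.integral_Iic_sub_Iic (a := 0) (b := x)
    integrable_stdPdf.integrableOn integrable_stdPdf.integrableOn
  simp only [stdCdf_eq_integral]
  linarith

lemma tendsto_stdPdf_atBot : Tendsto stdPdf atBot (𝓝 0) := by
  have h : Tendsto (fun w : ℝ => Real.exp (w / 2) / 2) atBot (𝓝 0) := by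
    have : Tendsto (fun w : ℝ => w / 2) atBot atBot := tendsto_id.atBot_div_const (by norm_num)
    simpa using (Real.tendsto_exp_atBot.comp this).div_const 2
  refine squeeze_zero' (Eventually.of_forall fun w => (stdPdf_pos w).le) ?_ h
  filter_upwards [eventually_le_atBot (-1)] with w hw
  refine (stdPdf_le_exp w).trans ?_
  gcongr
  nlinarith

/-! ### The mean of `max (w - Z) 0` for a standard normal `Z` -/

/-- `φ(w) + w Φ(w)`, the mean of the positive part of `w - Z` for a standard normal `Z`. -/
def hingeMean (w : ℝ) : ℝ := stdPdf w + w * stdCdf w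

lemma G_eq (w β : ℝ) : G w β = hingeMean w - β * w := rfl

lemma hasDerivAt_hingeMean (w : ℝ) : HasDerivAt hingeMean (stdCdf w) w := by
  have := (hasDerivAt_stdPdf w).add ((hasDerivAt_id w).mul (hasDerivAt_stdCdf w))
  refine this.congr_deriv ?_
  simp

lemma hasDerivAt_G (w β : ℝ) : HasDerivAt (fun w => G w β) (stdCdf w - β) w := by
  have := (hasDerivAt_hingeMean w).sub ((hasDerivAt_id w).const_mul β)
  refine this.congr_deriv ?_
  simp

lemma integrable_id_gaussianReal (m : ℝ) (v : ℝ≥0) : Integrable (fun x => x) (gaussianReal m v) :=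
  (memLp_id_gaussianReal' 1 (by simp)).integrable le_rfl

lemma integrable_hinge (w m : ℝ) (v : ℝ≥0) :
    Integrable (fun z => max (w - z) 0) (gaussianReal m v) :=
  ((integrable_const w).sub (integrable_id_gaussianReal m v)).sup (integrable_const 0)

lemma integral_hinge (w : ℝ) : ∫ z, max (w - z) 0 ∂(gaussianReal 0 1) = hingeMean w := by
  have hint : Integrable (fun z => stdPdf z * (w - z)) := by
    have h : Integrable (fun z => w - z) (gaussianReal 0 1) :=
      (integrable_const w).sub (integrable_id_gaussianReal 0 1)
    rw [gaussianReal_of_var_ne_zero 0 one_ne_zero, integrable_withDensity_iff_integrable_smul₀'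
      (measurable_gaussianPDF 0 1).aemeasurable
      (Eventually.of_forall fun _ => gaussianPDF_lt_top)] at h
    simp only [toReal_gaussianPDF, smul_eq_mul] at h
    exact h
  rw [integral_gaussianReal_eq_integral_smul one_ne_zero]
  have e : (fun z => gaussianPDFReal 0 1 z • max (w - z) 0)
      = (Set.Iic w).indicator fun z => stdPdf z * (w - z) := by
    ext z
    by_cases hz : z ≤ w
    · rw [Set.indicator_of_mem (show z ∈ Set.Iic w from hz), max_eq_left (by linarith)]; rfl
    · rw [Set.indicator_of_notMem (show z ∉ Set.Iic w from hz), max_eq_right (by linarith)]; simp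
  -- `w Φ(z) + φ(z)` is a primitive of `φ(z) (w - z)` that vanishes at `-∞`; at `z = w` it equals
  -- `hingeMean w`.
  have hd : ∀ z, HasDerivAt (fun z => w * stdCdf z + stdPdf z) (stdPdf z * (w - z)) z := fun z => by
    refine (((hasDerivAt_stdCdf z).const_mul w).add (hasDerivAt_stdPdf z)).congr_deriv ?_
    ring
  rw [e, integral_indicator measurableSet_Iic, integral_Iic_of_hasDerivAt_of_tendsto
    (hd w).continuousAt.continuousWithinAt (fun z _ => hd z) hint.integrableOn
    (m := 0) ?_]
  · simp [hingeMean]; ring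
  · have := ((tendsto_cdf_atBot (gaussianReal 0 1)).const_mul w).add tendsto_stdPdf_atBot
    rwa [mul_zero, zero_add] at this

lemma hingeMean_nonneg (w : ℝ) : 0 ≤ hingeMean w := by
  rw [← integral_hinge]; exact integral_nonneg fun z => le_max_right _ _

lemma integral_hinge_neg (w : ℝ) :
    ∫ z, max (z - w) 0 ∂(gaussianReal 0 1) = hingeMean (-w) := by
  have h : (gaussianReal 0 1).map (fun x => -x) = gaussianReal 0 1 := by
    simpa using gaussianReal_map_neg (μ := 0) (v := 1)
  rw [← integral_hinge, ← h, integral_map (by fun_prop) (by fun_prop), h]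
  congr 1; ext z; congr 1; ring

/-- Positive minus negative part of `w - Z` is `w - Z`, whose mean is `w`. This identity turns the
error of the right asymptote `(1 - β) w` of `G` into `hingeMean (-w)`. -/
lemma hingeMean_sub_neg (w : ℝ) : hingeMean w - hingeMean (-w) = w := by
  rw [← integral_hinge, ← integral_hinge_neg, ← integral_sub (integrable_hinge _ _ _)]
  · have : ∀ z : ℝ, max (w - z) 0 - max (z - w) 0 = w - z := fun z => by
      rcases le_total z w with h | h
      · rw [max_eq_left (by linarith), max_eq_right (by linarith)]; ring
      · rw [max_eq_right (by linarith), max_eq_left (by linarith)]; ring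
    simp only [this]
    rw [integral_sub (integrable_const w) (integrable_id_gaussianReal 0 1)]
    simp
  · exact ((integrable_id_gaussianReal 0 1).sub (integrable_const w)).sup (integrable_const 0)

lemma hingeMean_le_stdPdf {w : ℝ} (hw : w ≤ 0) : hingeMean w ≤ stdPdf w := by
  have := mul_nonneg (neg_nonneg.2 hw) (stdCdf_nonneg w)
  unfold hingeMean; linarith

lemma hingeMean_le (w : ℝ) : hingeMean w ≤ 1 / 2 + |w| := by
  have h1 := stdPdf_le_half w
  have h2 : w * stdCdf w ≤ |w| := by
    calc w * stdCdf w ≤ |w| * stdCdf w :=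
          mul_le_mul_of_nonneg_right (le_abs_self w) (stdCdf_nonneg w)
      _ ≤ |w| * 1 := mul_le_mul_of_nonneg_left (stdCdf_le_one w) (abs_nonneg w)
      _ = |w| := mul_one _
  unfold hingeMean; linarith

/-! ### Gaussian tails -/

lemma gaussianReal_map_affine (m s : ℝ) :
    (gaussianReal 0 1).map (fun z => m + s * z) = gaussianReal m (s ^ 2).toNNReal := by
  have h : (fun z : ℝ => m + s * z) = (fun x => m + x) ∘ fun z => s * z := rfl
  rw [h, ← Measure.map_map (by fun_prop) (by fun_prop), gaussianReal_map_const_mul,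
    gaussianReal_map_const_add]
  congr 1
  · simp
  · ext; simp [Real.coe_toNNReal _ (sq_nonneg s)]

/-- Mills' bound is the inequality `0 ≤ hingeMean (-t) = φ(t) - t Φ(-t)`. -/
lemma stdNormal_tail {t : ℝ} (ht : 0 < t) :
    (gaussianReal 0 1).real (Set.Iic (-t)) ≤ stdPdf t / t := by
  have h := hingeMean_nonneg (-t)
  have e : stdPdf (-t) = stdPdf t := by simp [stdPdf_eq]
  rw [← cdf_eq_real, le_div_iff₀ ht]
  change stdCdf (-t) * t ≤ _
  unfold hingeMean at h
  rw [e] at h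
  linarith

lemma gaussianReal_tail_le {m l s : ℝ} (hs : 0 < s) (hl : l < m) :
    (gaussianReal m (s ^ 2).toNNReal).real (Set.Iic l)
      ≤ stdPdf ((m - l) / s) / ((m - l) / s) := by
  rw [← gaussianReal_map_affine, map_measureReal_apply (by fun_prop) measurableSet_Iic]
  convert stdNormal_tail (t := (m - l) / s) (div_pos (by linarith) hs) using 2
  ext z
  simp only [Set.mem_preimage, Set.mem_Iic]
  rw [← neg_div, le_div_iff₀ hs]
  constructor <;> intro h <;> linarith

lemma gaussianReal_tail_ge {m l s : ℝ} (hs : 0 < s) (hl : m < l) :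
    (gaussianReal m (s ^ 2).toNNReal).real (Set.Ici l)
      ≤ stdPdf ((l - m) / s) / ((l - m) / s) := by
  have h := gaussianReal_map_neg (μ := -m) (v := (s ^ 2).toNNReal)
  rw [neg_neg] at h
  rw [← h, map_measureReal_apply (by fun_prop) measurableSet_Ici]
  convert gaussianReal_tail_le (m := -m) (l := -l) hs (by linarith) using 2
  · ext z; simp
  all_goals ring_nf

/-! ### Sums and differences of independent Gaussians -/

/-- The added noise has the variance of the observation, so sum and difference are uncorrelated and,
being jointly Gaussian, independent. This decouples the choice of branch from the value used in it.
-/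
lemma map_add_sub_gaussianReal (m : ℝ) (σ : ℝ≥0) :
    ((gaussianReal m σ).prod (gaussianReal 0 1)).map
        (fun p => (p.1 + √σ * p.2, p.1 - √σ * p.2))
      = (gaussianReal m (2 * σ)).prod (gaussianReal m (2 * σ)) := by
  let F : ℝ × ℝ →L[ℝ] ℝ × ℝ :=
    ((ContinuousLinearMap.fst ℝ ℝ ℝ) + √σ • ContinuousLinearMap.snd ℝ ℝ ℝ).prod
      ((ContinuousLinearMap.fst ℝ ℝ ℝ) - √σ • ContinuousLinearMap.snd ℝ ℝ ℝ)
  have hF : (fun p : ℝ × ℝ => (p.1 + √σ * p.2, p.1 - √σ * p.2)) = F := by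
    ext p <;> simp [F]
  rw [hF]
  refine Measure.ext_of_charFunDual (funext fun L => ?_)
  rw [charFunDual_map, charFunDual_prod, charFunDual_prod]
  simp only [IsGaussian.charFunDual_eq, ← Complex.exp_add, integral_complex_ofReal,
    integral_continuousLinearMap_gaussianReal, variance_continuousLinearMap_gaussianReal]
  -- With `L(x, y) = a x + b y` both characteristic functions are exponentials of quadratics in `(a,
  -- b)`; the exponents agree because `(a + b)² + (a - b)² = 2 a² + 2 b²`.
  obtain ⟨a, b, h⟩ : ∃ a b : ℝ, ∀ x y : ℝ, L (x, y) = x * a + y * b := by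
    refine ⟨L (1, 0), L (0, 1), fun x y => ?_⟩
    have : ((x, y) : ℝ × ℝ) = x • (1, 0) + y • (0, 1) := by simp
    rw [this, map_add, map_smul, map_smul]; rfl
  have hs : (√(σ : ℝ)) ^ 2 = σ := Real.sq_sqrt σ.2
  congr 1
  simp only [ContinuousLinearMap.comp_apply, ContinuousLinearMap.inl_apply,
    ContinuousLinearMap.inr_apply, F, ContinuousLinearMap.prod_apply]
  simp [h]
  have e : (√(σ : ℝ) * a + -(√(σ : ℝ) * b)) ^ 2 = σ * (a - b) ^ 2 := by
    linear_combination (a - b) ^ 2 * hs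
  rw [e, max_eq_left (by positivity), max_eq_left (by positivity), max_eq_left (by positivity),
    max_eq_left (by positivity)]
  push_cast
  ring

open Polynomial in
lemma integrable_eval_gaussianReal (p : ℝ[X]) (m : ℝ) (v : ℝ≥0) :
    Integrable (fun x => p.eval x) (gaussianReal m v) := by
  induction p using Polynomial.induction_on' with
  | add p q hp hq =>
    simp only [eval_add]
    exact hp.add hq
  | monomial n a =>
    have h := (memLp_id_gaussianReal' (μ := m) (v := v) (n : ℝ≥0∞) (by simp)).integrable_norm_pow'
    have h2 : Integrable (fun x : ℝ => x ^ n) (gaussianReal m v) := by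
      refine h.mono (by fun_prop) (Eventually.of_forall fun x => ?_)
      simp
    simpa using h2.const_mul a

open Polynomial in
/-- Gaussian integration by parts for polynomials. -/
lemma integral_sub_mul_eval_gaussianReal (p : ℝ[X]) (m : ℝ) :
    ∫ x, (x - m) * p.eval x ∂(gaussianReal m 1) = ∫ x, (derivative p).eval x ∂(gaussianReal m 1) := by
  have hint : ∀ q : ℝ[X], Integrable (fun x => gaussianPDFReal m 1 x * q.eval x) := fun q => by
    have h := integrable_eval_gaussianReal q m 1
    rw [gaussianReal_of_var_ne_zero m one_ne_zero, integrable_withDensity_iff_integrable_smul₀'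
      (measurable_gaussianPDF m 1).aemeasurable
      (Eventually.of_forall fun _ => gaussianPDF_lt_top)] at h
    simp only [toReal_gaussianPDF, smul_eq_mul] at h
    exact h
  have key := integral_mul_deriv_eq_deriv_mul_of_integrable
    (u := fun x => p.eval x) (u' := fun x => (derivative p).eval x)
    (v := gaussianPDFReal m 1) (v' := fun x => -((x - m) * gaussianPDFReal m 1 x))
    (fun x _ => p.hasDerivAt x) (fun x _ => hasDerivAt_gaussianPDFReal_one m x)
    (by
      have := (hint ((C m - X) * p))
      refine this.congr (Eventually.of_forall fun x => ?_)
      simp; ring)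
    (by
      refine (hint (derivative p)).congr (Eventually.of_forall fun x => ?_)
      simp; ring)
    (by
      refine (hint p).congr (Eventually.of_forall fun x => ?_)
      simp; ring)
  rw [integral_gaussianReal_eq_integral_smul one_ne_zero,
    integral_gaussianReal_eq_integral_smul one_ne_zero]
  simp only [smul_eq_mul]
  have e1 : ∫ x, gaussianPDFReal m 1 x * ((x - m) * p.eval x)
      = -∫ x, p.eval x * -((x - m) * gaussianPDFReal m 1 x) := by
    rw [← integral_neg]; congr 1; ext x; ring
  rw [e1, key, neg_neg]
  congr 1; ext x; ring

/-! ### Hermite polynomials under a shifted normal law -/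

open Polynomial in
/-- The probabilists' Hermite polynomial with real coefficients. -/
def hermiteReal (k : ℕ) : ℝ[X] := (hermite k).map (Int.castRingHom ℝ)

open Polynomial in
lemma aeval_hermite (k : ℕ) (x : ℝ) : aeval x (hermite k) = (hermiteReal k).eval x := by
  rw [hermiteReal, eval_map, aeval_def]; rfl

open Polynomial in
lemma hermiteReal_succ (k : ℕ) :
    hermiteReal (k + 1) = X * hermiteReal k - derivative (hermiteReal k) := by
  simp [hermiteReal, hermite_succ, derivative_map]

open Polynomial in
lemma derivative_hermiteReal_succ (k : ℕ) :
    derivative (hermiteReal (k + 1)) = (k + 1 : ℝ[X]) * hermiteReal k := by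
  induction k with
  | zero => simp [hermiteReal]
  | succ k ih =>
    have h : derivative (k + 1 : ℝ[X]) = 0 := by simp
    rw [hermiteReal_succ (k + 1), derivative_sub, derivative_mul, ih, derivative_mul, h,
      hermiteReal_succ k]
    simp
    ring

lemma hermiteZero_succ_succ (k : ℕ) : hermiteZero (k + 2) = -((k + 1) * hermiteZero k) := by
  simp only [hermiteZero, aeval_hermite]
  rw [hermiteReal_succ (k + 1), derivative_hermiteReal_succ]
  simp

lemma hermiteZero_zero : hermiteZero 0 = 1 := by simp [hermiteZero]

lemma hermiteZero_one : hermiteZero 1 = 0 := by simp [hermiteZero]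

lemma hermiteZero_sq_le (k : ℕ) : hermiteZero k ^ 2 ≤ k.factorial := by
  induction k using Nat.twoStepInduction with
  | zero => simp [hermiteZero_zero]
  | one => simp [hermiteZero_one]
  | more k ih _ =>
    rw [hermiteZero_succ_succ, Nat.factorial_succ, Nat.factorial_succ]
    push_cast
    have : (0 : ℝ) ≤ (k + 1) * k.factorial := by positivity
    nlinarith [sq_nonneg ((k : ℝ) + 1)]

/-- The mixed moment of two Hermite polynomials under `N(m, 1)`. -/
def hermiteMoment (m : ℝ) (k l : ℕ) : ℝ :=
  ∫ x, (hermiteReal k).eval x * (hermiteReal l).eval x ∂(gaussianReal m 1)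

-- Write `H_{k+1} p = (x - m) H_k p - (H_k p)' + m H_k p + H_k p'`; Gaussian integration by parts
-- cancels the first two terms in the mean.
open Polynomial in
lemma integral_hermiteReal_succ_mul (m : ℝ) (k : ℕ) (p : ℝ[X]) :
    ∫ x, (hermiteReal (k + 1)).eval x * p.eval x ∂(gaussianReal m 1)
      = m * ∫ x, (hermiteReal k).eval x * p.eval x ∂(gaussianReal m 1)
        + ∫ x, (hermiteReal k).eval x * (derivative p).eval x ∂(gaussianReal m 1) := by
  have hi : ∀ q : ℝ[X], Integrable (fun x => q.eval x) (gaussianReal m 1) :=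
    fun q => integrable_eval_gaussianReal q m 1
  have key := integral_sub_mul_eval_gaussianReal (hermiteReal k * p) m
  simp only [← eval_mul]
  rw [← integral_const_mul, ← integral_add ((hi _).const_mul m) (hi _)]
  have e : ∀ x, eval x (hermiteReal (k + 1) * p)
      = (x - m) * eval x (hermiteReal k * p) - eval x (derivative (hermiteReal k * p))
        + (m * eval x (hermiteReal k * p) + eval x (hermiteReal k * derivative p)) := fun x => by
    rw [hermiteReal_succ, derivative_mul]; simp; ring
  have h1 : Integrable (fun x => (x - m) * eval x (hermiteReal k * p)) (gaussianReal m 1) := by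
    have := hi ((X - C m) * (hermiteReal k * p))
    simp only [eval_mul (p := X - C m), eval_sub, eval_X, eval_C] at this
    exact this
  have h2 : Integrable (fun x => (x - m) * eval x (hermiteReal k * p)
      - eval x (derivative (hermiteReal k * p))) (gaussianReal m 1) := h1.sub (hi _)
  have h3 : Integrable (fun x => m * eval x (hermiteReal k * p)
      + eval x (hermiteReal k * derivative p)) (gaussianReal m 1) :=
    ((hi _).const_mul m).add (hi _)
  simp only [e]
  rw [integral_add h2 h3, integral_sub h1 (hi _), key, sub_self, zero_add]

lemma hermiteMoment_zero (m : ℝ) (l : ℕ) : hermiteMoment m 0 l = m ^ l := by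
  have h0 : ∀ x : ℝ, (hermiteReal 0).eval x = 1 := fun x => by simp [hermiteReal]
  induction l with
  | zero => simp [hermiteMoment, h0]
  | succ l ih =>
    have h := integral_hermiteReal_succ_mul m l 1
    simp only [hermiteMoment, h0, one_mul] at ih ⊢
    simp only [Polynomial.eval_one, mul_one, Polynomial.derivative_one, Polynomial.eval_zero,
      mul_zero, integral_zero, add_zero] at h
    rw [h, ih, pow_succ']

lemma hermiteMoment_succ_succ (m : ℝ) (k l : ℕ) :
    hermiteMoment m (k + 1) (l + 1)
      = m * hermiteMoment m k (l + 1) + (l + 1) * hermiteMoment m k l := by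
  simp only [hermiteMoment]
  rw [integral_hermiteReal_succ_mul, derivative_hermiteReal_succ, ← integral_const_mul (l + 1 : ℝ)]
  congr 2; ext x; simp; ring

/-- Induction on `k` through `hermiteMoment_succ_succ`, which leaves the diagonal; hence the factor
`|m| ^ (l - k)`, although only `k = l` is needed later. The fixed `N` bounds every degree met, so
each step multiplies by the same `N + m²`. -/
lemma abs_hermiteMoment_le (m : ℝ) (N k l : ℕ) (hkl : k ≤ l) (hl : l ≤ N) :
    |hermiteMoment m k l| ≤ (N + m ^ 2) ^ k * |m| ^ (l - k) := by
  induction k generalizing l with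
  | zero => simp [hermiteMoment_zero]
  | succ k ih =>
    obtain ⟨j, rfl⟩ := Nat.exists_eq_add_of_le hkl
    have h1 := ih (k + 1 + j) (by omega) hl
    have h2 := ih (k + j) (by omega) (by omega)
    rw [show k + 1 + j - k = j + 1 by omega] at h1
    rw [show k + j - k = j by omega] at h2
    rw [show k + 1 + j = (k + j) + 1 by omega] at h1 ⊢
    rw [hermiteMoment_succ_succ, show k + j + 1 - (k + 1) = j by omega]
    have hN : ((k + j : ℕ) : ℝ) + 1 ≤ N := by exact_mod_cast (by omega : k + j + 1 ≤ N)
    have hN0 : (0 : ℝ) ≤ ((k + j : ℕ) : ℝ) + 1 := by positivity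
    calc _ ≤ |m| * |hermiteMoment m k (k + j + 1)|
          + (((k + j : ℕ) : ℝ) + 1) * |hermiteMoment m k (k + j)| := by
          refine (abs_add_le _ _).trans_eq ?_
          rw [abs_mul, abs_mul, abs_of_nonneg hN0]
      _ ≤ |m| * ((N + m ^ 2) ^ k * |m| ^ (j + 1)) + N * ((N + m ^ 2) ^ k * |m| ^ j) := by
          gcongr
      _ = (N + m ^ 2) ^ (k + 1) * |m| ^ j := by
          rw [← sq_abs m]; ring

/-- For `U ∼ N(μ, v)` with `v = s² > 0`, the mean of `v^{k/2} H_k(U / √v)` is `μ^k`. -/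
lemma integral_scaledHermite (k : ℕ) {μ s : ℝ} (hs : 0 < s) :
    Integrable (scaledHermite k (s ^ 2)) (gaussianReal μ (s ^ 2).toNNReal) ∧
    Integrable (fun u => scaledHermite k (s ^ 2) u ^ 2) (gaussianReal μ (s ^ 2).toNNReal) ∧
    ∫ u, scaledHermite k (s ^ 2) u ∂(gaussianReal μ (s ^ 2).toNNReal) = μ ^ k ∧
    ∫ u, scaledHermite k (s ^ 2) u ^ 2 ∂(gaussianReal μ (s ^ 2).toNNReal)
      ≤ (k * s ^ 2 + μ ^ 2) ^ k := by
  have hv : s ^ 2 ≠ 0 := by positivity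
  have hS : ∀ u, scaledHermite k (s ^ 2) u = s ^ k * (hermiteReal k).eval (u / s) := fun u => by
    rw [scaledHermite, if_neg hv, Real.sqrt_sq hs.le, aeval_hermite]
  have hlaw : (gaussianReal μ (s ^ 2).toNNReal).map (fun u => u / s) = gaussianReal (μ / s) 1 := by
    rw [gaussianReal_map_div_const]
    congr 1
    ext; simp [Real.coe_toNNReal _ (sq_nonneg s), hv]
  have hm : AEMeasurable (fun u => u / s) (gaussianReal μ (s ^ 2).toNNReal) := by fun_prop
  have hi : ∀ q : Polynomial ℝ,
      Integrable (fun u => q.eval (u / s)) (gaussianReal μ (s ^ 2).toNNReal) := fun q => by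
    have h := integrable_eval_gaussianReal q (μ / s) 1
    rw [← hlaw] at h
    exact (integrable_map_measure (by fun_prop) hm).1 h
  have ht : ∀ q : Polynomial ℝ, ∫ u, q.eval (u / s) ∂(gaussianReal μ (s ^ 2).toNNReal)
      = ∫ x, q.eval x ∂(gaussianReal (μ / s) 1) := fun q => by
    rw [← hlaw, integral_map hm (by fun_prop)]
  have hsq : ∀ u, scaledHermite k (s ^ 2) u ^ 2
      = (s ^ k) ^ 2 * (hermiteReal k * hermiteReal k).eval (u / s) := fun u => by
    rw [hS, Polynomial.eval_mul]; ring
  refine ⟨?_, ?_, ?_, ?_⟩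
  · exact ((hi (hermiteReal k)).const_mul _).congr (Eventually.of_forall fun u => (hS u).symm)
  · exact ((hi (hermiteReal k * hermiteReal k)).const_mul _).congr
      (Eventually.of_forall fun u => (hsq u).symm)
  · simp only [hS]
    rw [integral_const_mul, ht]
    have h0 : ∀ x : ℝ, (hermiteReal 0).eval x = 1 := fun x => by simp [hermiteReal]
    have := hermiteMoment_zero (μ / s) k
    simp only [hermiteMoment, h0, one_mul] at this
    rw [this, div_pow]
    field_simp
  · simp only [hsq]
    rw [integral_const_mul, ht]
    have := (le_abs_self _).trans (abs_hermiteMoment_le (μ / s) k k k le_rfl le_rfl)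
    simp only [hermiteMoment, ← Polynomial.eval_mul, Nat.sub_self, pow_zero, mul_one] at this
    calc _ ≤ (s ^ k) ^ 2 * (k + (μ / s) ^ 2) ^ k := by gcongr
      _ = (k * s ^ 2 + μ ^ 2) ^ k := by
        rw [← pow_mul, mul_comm k 2, pow_mul, ← mul_pow]
        congr 1; field_simp

/-! ### The Taylor polynomial of `G` and its unbiased estimate -/

/-- The coefficient of `w ^ (k + 2)` in the power series of `G` at `0`, divided by `φ(0)`. -/
def taylorCoeff (k : ℕ) : ℝ := (-1) ^ k * hermiteZero k / (Nat.factorial (k + 2) : ℝ)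

/-- The Taylor polynomial of `G(·, β)` of degree `N + 1` at `0`. -/
def taylorG (β : ℝ) (N : ℕ) (w : ℝ) : ℝ :=
  G 0 β + deriv (fun w => G w β) 0 * w
    + stdPdf 0 * ∑ k ∈ Finset.range N, taylorCoeff k * w ^ (k + 2)

/-- The estimate of `taylorG β N μ` from one observation of `N(μ, v)`. -/
def hermiteG (β : ℝ) (N : ℕ) (v u : ℝ) : ℝ :=
  G 0 β + deriv (fun w => G w β) 0 * u
    + stdPdf 0 * ∑ k ∈ Finset.range N, taylorCoeff k * scaledHermite (k + 2) v u

lemma deriv_G (w β : ℝ) : deriv (fun w => G w β) w = stdCdf w - β := (hasDerivAt_G w β).deriv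

lemma G_zero (β : ℝ) : G 0 β = stdPdf 0 := by simp [G]

lemma taylorCoeff_sq_le (k : ℕ) : taylorCoeff k ^ 2 ≤ 1 / (k + 2).factorial := by
  have h1 := hermiteZero_sq_le k
  have h2 : (k.factorial : ℝ) ≤ (k + 2).factorial := by
    exact_mod_cast Nat.factorial_le (by omega)
  have h3 : (0 : ℝ) < (k + 2).factorial := by positivity
  rw [taylorCoeff, div_pow, mul_pow, ← pow_mul, mul_comm k 2, pow_mul]
  rw [div_le_div_iff₀ (by positivity) h3]
  norm_num
  nlinarith

lemma exp_one_bounds : 2.7 < Real.exp 1 ∧ Real.exp 1 < 2.72 :=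
  ⟨by linarith [Real.exp_one_gt_d9], by linarith [Real.exp_one_lt_d9]⟩

/-- Apply `x^l / l! ≤ e^x` to `x = (e/2)(l v + μ²)`. For `v ≤ 1/(2e)` the variance part contributes
at most `e^{l/4}`, which the factor `(e/2)^l` on the left absorbs. -/
lemma pow_le_factorial_mul_exp {μ v : ℝ} (hv0 : 0 ≤ v) (hv : v ≤ 1 / (2 * Real.exp 1)) (l : ℕ) :
    (l * v + μ ^ 2) ^ l ≤ l.factorial * Real.exp (Real.exp 1 * μ ^ 2 / 2) := by
  have he := Real.exp_pos 1
  have h1 := Real.pow_div_factorial_le_exp (Real.exp 1 / 2 * (l * v + μ ^ 2)) (by positivity) l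
  rw [div_le_iff₀ (by positivity), mul_pow] at h1
  have h2 : Real.exp (Real.exp 1 / 2 * (l * v + μ ^ 2))
      ≤ Real.exp (1 / 4) ^ l * Real.exp (Real.exp 1 * μ ^ 2 / 2) := by
    rw [← Real.exp_nat_mul, ← Real.exp_add]
    refine Real.exp_le_exp.2 ?_
    have : Real.exp 1 / 2 * v ≤ 1 / 4 := by
      calc _ ≤ Real.exp 1 / 2 * (1 / (2 * Real.exp 1)) := by gcongr
        _ = 1 / 4 := by field_simp; norm_num
    nlinarith [(Nat.cast_nonneg l : (0 : ℝ) ≤ l)]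
  -- Equivalent to `e^{3/4} ≥ 2`, that is `e³ ≥ 16`; and `2.7³ > 16`.
  have h3 : Real.exp (1 / 4) ≤ Real.exp 1 / 2 := by
    have : Real.exp 1 = Real.exp (1 / 4) ^ 4 := by rw [← Real.exp_nat_mul]; norm_num
    by_contra! hc
    have h4 : (2 : ℝ) ≤ Real.exp (1 / 4) ^ 3 ∨ Real.exp (1 / 4) ^ 3 < 2 := le_or_gt _ _
    rcases h4 with h4 | h4
    · nlinarith [Real.exp_pos (1 / 4)]
    · have : Real.exp 1 ^ 3 < 2 ^ 4 := by
        calc Real.exp 1 ^ 3 = (Real.exp (1 / 4) ^ 3) ^ 4 := by rw [this]; ring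
          _ < 2 ^ 4 := pow_lt_pow_left₀ h4 (by positivity) (by norm_num)
      have h5 : (2.7 : ℝ) ^ 3 < Real.exp 1 ^ 3 :=
        pow_lt_pow_left₀ exp_one_bounds.1 (by norm_num) (by norm_num)
      norm_num at h5 this; linarith
  have h4 : Real.exp (1 / 4) ^ l ≤ (Real.exp 1 / 2) ^ l :=
    pow_le_pow_left₀ (Real.exp_pos _).le h3 l
  have h5 : (0 : ℝ) < (Real.exp 1 / 2) ^ l := by positivity
  refine le_of_mul_le_mul_left ?_ h5
  calc _ ≤ _ := h1
    _ ≤ Real.exp (1 / 4) ^ l * Real.exp (Real.exp 1 * μ ^ 2 / 2) * l.factorial := by gcongr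
    _ ≤ (Real.exp 1 / 2) ^ l * Real.exp (Real.exp 1 * μ ^ 2 / 2) * l.factorial := by gcongr
    _ = _ := by ring

lemma scaledHermite_one {v : ℝ} (hv : 0 < v) (u : ℝ) : scaledHermite 1 v u = u := by
  have : √v ≠ 0 := (Real.sqrt_pos.2 hv).ne'
  simp [scaledHermite, hv.ne']
  field_simp

lemma integrable_hermiteG (β : ℝ) (N : ℕ) {μ s : ℝ} (hs : 0 < s) :
    Integrable (hermiteG β N (s ^ 2)) (gaussianReal μ (s ^ 2).toNNReal) := by
  refine ((integrable_const _).add ((integrable_id_gaussianReal _ _).const_mul _)).add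
    (Integrable.const_mul (integrable_finsetSum _ fun k _ => ?_) _)
  exact ((integral_scaledHermite (k + 2) hs).1).const_mul _

lemma integral_hermiteG (β : ℝ) (N : ℕ) {μ s : ℝ} (hs : 0 < s) :
    ∫ u, hermiteG β N (s ^ 2) u ∂(gaussianReal μ (s ^ 2).toNNReal) = taylorG β N μ := by
  have h1 : Integrable (fun u => G 0 β + deriv (fun w => G w β) 0 * u)
      (gaussianReal μ (s ^ 2).toNNReal) :=
    (integrable_const _).add ((integrable_id_gaussianReal _ _).const_mul _)
  have h2 : ∀ k ∈ Finset.range N, Integrable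
      (fun u => taylorCoeff k * scaledHermite (k + 2) (s ^ 2) u)
      (gaussianReal μ (s ^ 2).toNNReal) :=
    fun k _ => ((integral_scaledHermite (k + 2) hs).1).const_mul _
  simp only [hermiteG, taylorG]
  rw [integral_add h1 ((integrable_finsetSum _ h2).const_mul _),
    integral_add (integrable_const _) ((integrable_id_gaussianReal _ _).const_mul _),
    integral_const_mul, integral_const_mul, integral_finsetSum _ h2]
  simp only [integral_const_mul, (integral_scaledHermite (_ + 2) hs).2.2.1, integral_id_gaussianReal]
  simp

/-- Second moment of the unbiased estimate of the Taylor polynomial. -/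
lemma integral_hermiteG_sq_le {β : ℝ} (hβ0 : 0 ≤ β) (hβ1 : β ≤ 1) (N : ℕ) {μ s : ℝ} (hs : 0 < s)
    (hv : s ^ 2 ≤ 1 / (2 * Real.exp 1)) :
    Integrable (fun u => hermiteG β N (s ^ 2) u ^ 2) (gaussianReal μ (s ^ 2).toNNReal) ∧
    ∫ u, hermiteG β N (s ^ 2) u ^ 2 ∂(gaussianReal μ (s ^ 2).toNNReal)
      ≤ 6 * (N + 1) ^ 2 * Real.exp (Real.exp 1 * μ ^ 2 / 2) := by
  set B := Real.exp (Real.exp 1 * μ ^ 2 / 2)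
  set γ := gaussianReal μ (s ^ 2).toNNReal
  have he := exp_one_bounds
  have hB : 1 + μ ^ 2 ≤ B := by
    have := Real.add_one_le_exp (Real.exp 1 * μ ^ 2 / 2)
    nlinarith [sq_nonneg μ]
  have hs1 : s ^ 2 ≤ 1 := by
    refine hv.trans ?_
    rw [div_le_one (by positivity)]; linarith
  let D := deriv (fun w => G w β) 0
  have hD : D ^ 2 ≤ 1 := by
    have h0 := stdCdf_nonneg 0
    have h1 := stdCdf_le_one 0
    have : D = stdCdf 0 - β := deriv_G 0 β
    rw [this]; nlinarith
  have hφ : stdPdf 0 ^ 2 ≤ 1 := by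
    have := stdPdf_le_half 0
    have := (stdPdf_pos 0).le
    nlinarith
  -- Cauchy–Schwarz twice: a factor `3` for the three pieces and a factor `N` for the sum. No
  -- orthogonality is used, since an extra power of `N ~ log n` is harmless.
  let F : ℝ → ℝ := fun u => 3 * (stdPdf 0 ^ 2 + D ^ 2 * scaledHermite 1 (s ^ 2) u ^ 2
    + stdPdf 0 ^ 2 * (N * ∑ k ∈ Finset.range N,
        taylorCoeff k ^ 2 * scaledHermite (k + 2) (s ^ 2) u ^ 2))
  have hle : ∀ u, hermiteG β N (s ^ 2) u ^ 2 ≤ F u := fun u => by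
    have h1 := sq_sum_le_card_mul_sum_sq (s := Finset.range N)
      (f := fun k => taylorCoeff k * scaledHermite (k + 2) (s ^ 2) u)
    simp only [mul_pow, Finset.card_range] at h1
    have h2 : ∀ a b c : ℝ, (a + b + c) ^ 2 ≤ 3 * (a ^ 2 + b ^ 2 + c ^ 2) := fun a b c => by
      nlinarith [sq_nonneg (a - b), sq_nonneg (a - c), sq_nonneg (b - c)]
    refine (h2 _ _ _).trans ?_
    simp only [F, G_zero, scaledHermite_one (show 0 < s ^ 2 by positivity), mul_pow]
    gcongr
  have hI1 := (integral_scaledHermite (μ := μ) 1 hs).2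
  have hIk := fun k => (integral_scaledHermite (μ := μ) (k + 2) hs).2
  have hJ1 : Integrable (fun u => stdPdf 0 ^ 2 + D ^ 2 * scaledHermite 1 (s ^ 2) u ^ 2) γ :=
    (integrable_const _).add (hI1.1.const_mul _)
  have hJ2 : ∀ k ∈ Finset.range N, Integrable
      (fun u => taylorCoeff k ^ 2 * scaledHermite (k + 2) (s ^ 2) u ^ 2) γ :=
    fun k _ => (hIk k).1.const_mul _
  have hJ3 : Integrable (fun u => stdPdf 0 ^ 2 * (N * ∑ k ∈ Finset.range N,
        taylorCoeff k ^ 2 * scaledHermite (k + 2) (s ^ 2) u ^ 2)) γ :=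
    ((integrable_finsetSum _ hJ2).const_mul _).const_mul _
  have hF : Integrable F γ := (hJ1.add hJ3).const_mul 3
  have hmeas : AEStronglyMeasurable (fun u => hermiteG β N (s ^ 2) u ^ 2) γ :=
    (integrable_hermiteG β N hs).aestronglyMeasurable.pow 2
  refine ⟨hF.mono' hmeas (Eventually.of_forall fun u => ?_), ?_⟩
  · rw [Real.norm_of_nonneg (sq_nonneg _)]; exact hle u
  have hmono : ∫ u, hermiteG β N (s ^ 2) u ^ 2 ∂γ ≤ ∫ u, F u ∂γ :=
    integral_mono_of_nonneg (Eventually.of_forall fun u => sq_nonneg _) hF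
      (Eventually.of_forall hle)
  refine hmono.trans ?_
  simp only [F]
  rw [integral_const_mul, integral_add hJ1 hJ3, integral_add (integrable_const _)
    (hI1.1.const_mul _), integral_const_mul, integral_const_mul, integral_const_mul,
    integral_finsetSum _ hJ2]
  -- The factorial in the squared coefficient cancels the one in the second moment of the Hermite
  -- term, so every degree contributes at most the same `B`.
  have hterm : ∀ k ∈ Finset.range N,
      ∫ u, taylorCoeff k ^ 2 * scaledHermite (k + 2) (s ^ 2) u ^ 2 ∂γ ≤ B := fun k _ => by
    have h3 : (0 : ℝ) < (k + 2).factorial := by positivity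
    rw [integral_const_mul]
    calc _ ≤ 1 / ((k + 2).factorial : ℝ) * ((k + 2).factorial * B) := by
          refine mul_le_mul (taylorCoeff_sq_le k) ((hIk k).2.2.trans ?_)
            (integral_nonneg fun u => sq_nonneg _) (by positivity)
          exact pow_le_factorial_mul_exp (sq_nonneg s) hv (k + 2)
      _ = B := by field_simp
  have hsum := Finset.sum_le_sum hterm
  rw [Finset.sum_const, Finset.card_range, nsmul_eq_mul] at hsum
  have hone : D ^ 2 * ∫ u, scaledHermite 1 (s ^ 2) u ^ 2 ∂γ ≤ B := by
    have h := hI1.2.2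
    simp only [Nat.cast_one, one_mul, pow_one] at h
    have h0 : 0 ≤ ∫ u, scaledHermite 1 (s ^ 2) u ^ 2 ∂γ := integral_nonneg fun u => sq_nonneg _
    nlinarith
  have hc : ∫ _, stdPdf 0 ^ 2 ∂γ = stdPdf 0 ^ 2 := by simp [γ]
  rw [hc]
  have hsum0 : stdPdf 0 ^ 2 * (N * ∑ k ∈ Finset.range N,
      ∫ u, taylorCoeff k ^ 2 * scaledHermite (k + 2) (s ^ 2) u ^ 2 ∂γ) ≤ 1 * (N * (N * B)) := by
    gcongr
  have hN : (0 : ℝ) ≤ N := Nat.cast_nonneg N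
  have hB1 : 1 ≤ B := by nlinarith [sq_nonneg μ]
  have hNB : 0 ≤ N * B := by positivity
  have hNNB : 0 ≤ N * (N * B) := by positivity
  nlinarith

/-! ### Truncation error of the Taylor polynomial -/

/-- Rankin's trick: in the tail `m ≥ p` each term may be multiplied by `a^{m-p} ≥ 1`, after which
the full series of `exp (a y)` bounds it. -/
lemma exp_sub_sum_le {a y : ℝ} (ha : 1 ≤ a) (hy : 0 ≤ y) (p : ℕ) :
    Real.exp y - ∑ m ∈ Finset.range p, y ^ m / m.factorial ≤ Real.exp (a * y) / a ^ p := by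
  have hexp : ∀ z : ℝ, HasSum (fun m : ℕ => z ^ m / m.factorial) (Real.exp z) := fun z => by
    rw [Real.exp_eq_exp_ℝ]; exact NormedSpace.expSeries_div_hasSum_exp z
  have ha0 : 0 < a := by linarith
  have h1 : HasSum (fun m : ℕ => a ^ p * (y ^ m / m.factorial) - (a * y) ^ m / m.factorial)
      (a ^ p * Real.exp y - Real.exp (a * y)) := ((hexp y).mul_left _).sub (hexp _)
  have h2 : HasSum (fun m : ℕ => if m ∈ Finset.range p then a ^ p * (y ^ m / m.factorial) else 0)
      (∑ m ∈ Finset.range p, if m ∈ Finset.range p then a ^ p * (y ^ m / m.factorial) else 0) :=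
    hasSum_sum_of_ne_finset_zero fun m hm => if_neg hm
  rw [Finset.sum_ite_mem, Finset.inter_self, ← Finset.mul_sum] at h2
  have h3 := hasSum_le (fun m => ?_) h1 h2
  · rw [le_div_iff₀ (by positivity)]; linarith
  · split_ifs with hm
    · have : 0 ≤ (a * y) ^ m / m.factorial := by positivity
      linarith
    · have : a ^ p ≤ a ^ m := pow_le_pow_right₀ ha (by simpa using hm)
      have h0 : 0 ≤ y ^ m / m.factorial := by positivity
      rw [mul_pow, mul_div_assoc]
      nlinarith

lemma hermiteZero_odd (m : ℕ) : hermiteZero (2 * m + 1) = 0 := by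
  induction m with
  | zero => exact hermiteZero_one
  | succ m ih =>
    rw [show 2 * (m + 1) + 1 = (2 * m + 1) + 2 by ring, hermiteZero_succ_succ, ih]; simp

lemma hermiteZero_even_div (m : ℕ) :
    hermiteZero (2 * m) / ((2 * m).factorial : ℝ) = (-1 / 2) ^ m / m.factorial := by
  induction m with
  | zero => simp [hermiteZero_zero]
  | succ m ih =>
    rw [show 2 * (m + 1) = 2 * m + 2 by ring, hermiteZero_succ_succ, Nat.factorial_succ,
      Nat.factorial_succ, Nat.factorial_succ m, pow_succ]
    rw [div_eq_div_iff (by positivity) (by positivity)] at ih ⊢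
    push_cast
    linear_combination (-(2 * (m : ℝ) + 1) * (m + 1)) * ih

/-- `H_k(0)` vanishes for odd `k`, so the series of `φ / φ(0)` is that of `exp (-w²/2)`. There are
`(N + 1) / 2` even indices below `N`. -/
lemma sum_hermiteZero (N : ℕ) (w : ℝ) :
    ∑ k ∈ Finset.range N, (-1) ^ k * hermiteZero k / (k.factorial : ℝ) * w ^ k
      = ∑ m ∈ Finset.range ((N + 1) / 2), (-(w ^ 2 / 2)) ^ m / m.factorial := by
  have heven : ∀ m : ℕ, (-1) ^ (2 * m) * hermiteZero (2 * m) / ((2 * m).factorial : ℝ) * w ^ (2 * m)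
      = (-(w ^ 2 / 2)) ^ m / m.factorial := fun m => by
    rw [mul_div_assoc, hermiteZero_even_div, pow_mul, pow_mul,
      show -(w ^ 2 / 2) = (-1 / 2) * w ^ 2 by ring, mul_pow]
    norm_num; ring
  have hq : ∀ q : ℕ, ∑ k ∈ Finset.range (2 * q),
      (-1) ^ k * hermiteZero k / (k.factorial : ℝ) * w ^ k
      = ∑ m ∈ Finset.range q, (-(w ^ 2 / 2)) ^ m / m.factorial := fun q => by
    induction q with
    | zero => simp
    | succ q ih =>
      rw [show 2 * (q + 1) = 2 * q + 1 + 1 by ring, Finset.sum_range_succ, Finset.sum_range_succ,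
        ih, heven, hermiteZero_odd, Finset.sum_range_succ]
      simp
  rcases Nat.even_or_odd' N with ⟨q, rfl | rfl⟩
  · rw [hq, show (2 * q + 1) / 2 = q by omega]
  · rw [Finset.sum_range_succ, hq, heven, show (2 * q + 1 + 1) / 2 = q + 1 by omega,
      Finset.sum_range_succ]

lemma abs_sum_hermiteZero_sub_le {M w : ℝ} (N : ℕ) (hw : |w| ≤ M)
    (hN : Real.exp 1 ^ 2 * M ^ 2 ≤ N) :
    |∑ k ∈ Finset.range N, (-1) ^ k * hermiteZero k / (k.factorial : ℝ) * w ^ k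
      - Real.exp (-(w ^ 2 / 2))| ≤ Real.exp (-(3 * M ^ 2)) := by
  set p := (N + 1) / 2
  have hp : (N : ℝ) / 2 ≤ p := by
    have : N ≤ 2 * p := by omega
    have : (N : ℝ) ≤ 2 * p := by exact_mod_cast this
    linarith
  have hwM : w ^ 2 ≤ M ^ 2 := sq_le_sq' (by linarith [neg_abs_le w]) (by linarith [le_abs_self w])
  -- The remainder at a negative argument is dominated by the remainder at its absolute value.
  have h1 := Complex.norm_exp_sub_sum_le_exp_norm_sub_sum ((-(w ^ 2 / 2) : ℝ) : ℂ) p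
  -- With `a = e²` the remainder is at most `exp (e² w²/2 - 2p)`. Since `w² ≤ M²` and `2p ≥ N ≥ e²
  -- M²`, the exponent is at most `-e² M²/2`, and `e² ≥ 7`.
  have h2 := exp_sub_sum_le (a := Real.exp 2) (y := w ^ 2 / 2)
    (Real.one_le_exp (by norm_num)) (by positivity) p
  rw [Complex.norm_real, Real.norm_eq_abs, abs_neg, abs_of_nonneg (by positivity)] at h1
  rw [sum_hermiteZero, abs_sub_comm]
  have h3 : ‖Complex.exp ((-(w ^ 2 / 2) : ℝ) : ℂ)
      - ∑ m ∈ Finset.range p, ((-(w ^ 2 / 2) : ℝ) : ℂ) ^ m / m.factorial‖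
      = |Real.exp (-(w ^ 2 / 2)) - ∑ m ∈ Finset.range p, (-(w ^ 2 / 2)) ^ m / m.factorial| := by
    rw [← Real.norm_eq_abs, ← Complex.norm_real]
    push_cast; rfl
  rw [h3] at h1
  refine h1.trans (h2.trans ?_)
  rw [← Real.exp_nat_mul, ← Real.exp_sub]
  refine Real.exp_le_exp.2 ?_
  have he2 : Real.exp 1 ^ 2 = Real.exp 2 := by rw [← Real.exp_nat_mul]; norm_num
  have he7 : 7 ≤ Real.exp 2 := by
    rw [← he2]; nlinarith [exp_one_bounds.1]
  rw [he2] at hN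
  nlinarith [sq_nonneg M]

lemma abs_le_of_abs_deriv_le {f f' : ℝ → ℝ} {C M w : ℝ} (hf : ∀ x, HasDerivAt f (f' x) x)
    (h0 : f 0 = 0) (hC : ∀ x, |x| ≤ M → |f' x| ≤ C) (hw : |w| ≤ M) : |f w| ≤ C * M := by
  have hM : 0 ≤ M := (abs_nonneg w).trans hw
  have hC0 : 0 ≤ C := (abs_nonneg _).trans (hC 0 (by simpa using hM))
  have := (convex_Icc (-M) M).norm_image_sub_le_of_norm_hasDerivWithin_le
    (f := f) (f' := f') (C := C) (fun x _ => (hf x).hasDerivWithinAt)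
    (fun x hx => hC x (abs_le.2 hx)) (x := 0) (y := w) ⟨by linarith, hM⟩ (abs_le.1 hw)
  rw [h0, sub_zero, sub_zero, Real.norm_eq_abs, Real.norm_eq_abs] at this
  exact this.trans (by gcongr)

/-- The Taylor polynomial of `G` is exponentially accurate on `[-M, M]` once its degree exceeds
`e² M²`. -/
lemma abs_taylorG_sub_G_le (β : ℝ) {M w : ℝ} (N : ℕ) (hw : |w| ≤ M)
    (hN : Real.exp 1 ^ 2 * M ^ 2 ≤ N) :
    |taylorG β N w - G w β| ≤ Real.exp (-(3 * M ^ 2)) * M * M := by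
  -- Since `G'' = φ`, the second derivative of the error is `φ(0)` times the error of the series of
  -- `exp (-x²/2)`. The error and its first derivative vanish at `0`, so integrating twice costs a
  -- factor `M` each time.
  let D1 : ℝ → ℝ := fun w => deriv (fun w => G w β) 0
    + stdPdf 0 * ∑ k ∈ Finset.range N, taylorCoeff k * ((k + 2 : ℕ) * w ^ (k + 1))
    - (stdCdf w - β)
  let D2 : ℝ → ℝ := fun w => stdPdf 0 * ∑ k ∈ Finset.range N,
    taylorCoeff k * ((k + 2 : ℕ) * ((k + 1 : ℕ) * w ^ k)) - stdPdf w
  have h1 : ∀ x, HasDerivAt (fun w => taylorG β N w - G w β) (D1 x) x := fun x => by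
    refine HasDerivAt.sub (HasDerivAt.add ?_ (HasDerivAt.const_mul _ ?_)) (hasDerivAt_G x β)
    · simpa using ((hasDerivAt_id x).const_mul (deriv (fun w => G w β) 0)).const_add (G 0 β)
    · exact HasDerivAt.fun_sum fun k _ => (hasDerivAt_pow (k + 2) x).const_mul _
  have h2 : ∀ x, HasDerivAt D1 (D2 x) x := fun x => by
    refine HasDerivAt.sub (HasDerivAt.const_add _ (HasDerivAt.const_mul _ ?_))
      ((hasDerivAt_stdCdf x).sub_const β)
    exact HasDerivAt.fun_sum fun k _ =>
      ((hasDerivAt_pow (k + 1) x).const_mul _).const_mul _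
  have hD2 : ∀ x, |x| ≤ M → |D2 x| ≤ Real.exp (-(3 * M ^ 2)) := fun x hx => by
    have e : D2 x = stdPdf 0 * (∑ k ∈ Finset.range N,
        (-1) ^ k * hermiteZero k / (k.factorial : ℝ) * x ^ k - Real.exp (-(x ^ 2 / 2))) := by
      simp only [D2]
      rw [stdPdf_eq_zero_mul x, mul_sub]
      congr 2
      refine Finset.sum_congr rfl fun k _ => ?_
      rw [taylorCoeff, Nat.factorial_succ, Nat.factorial_succ]
      push_cast
      field_simp
      ring
    rw [e, abs_mul, abs_of_pos (stdPdf_pos 0)]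
    have := abs_sum_hermiteZero_sub_le N hx hN
    have h3 := stdPdf_le_half 0
    nlinarith [stdPdf_pos 0, abs_nonneg (∑ k ∈ Finset.range N,
        (-1) ^ k * hermiteZero k / (k.factorial : ℝ) * x ^ k - Real.exp (-(x ^ 2 / 2)))]
  refine abs_le_of_abs_deriv_le (f := fun w => taylorG β N w - G w β) h1 ?_ (fun x hx => abs_le_of_abs_deriv_le h2 ?_ hD2 hx) hw
  · simp [taylorG]
  · simp [D1, deriv_G]

/-! ### Truncation at level `n` -/

/-- `x` truncated to `[-n, n]`. -/
def clip (n x : ℝ) : ℝ := Real.sign x * min |x| n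

lemma abs_clip_le_abs {n : ℝ} (hn : 0 ≤ n) (x : ℝ) : |clip n x| ≤ |x| := by
  have h0 : 0 ≤ min |x| n := le_min (abs_nonneg x) hn
  rw [clip, abs_mul, abs_of_nonneg h0]
  have : |Real.sign x| ≤ 1 := by
    rcases Real.sign_apply_eq x with h | h | h <;> simp [h]
  calc |Real.sign x| * min |x| n ≤ 1 * |x| := by gcongr; exact min_le_left _ _
    _ = |x| := one_mul _

lemma abs_clip_le {n : ℝ} (hn : 0 ≤ n) (x : ℝ) : |clip n x| ≤ n := by
  have h0 : 0 ≤ min |x| n := le_min (abs_nonneg x) hn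
  rw [clip, abs_mul, abs_of_nonneg h0]
  have : |Real.sign x| ≤ 1 := by
    rcases Real.sign_apply_eq x with h | h | h <;> simp [h]
  calc |Real.sign x| * min |x| n ≤ 1 * n := by gcongr; exact min_le_right _ _
    _ = n := one_mul _

/-- There is no error for `|x| ≤ n`; otherwise it is at most `|x| ≤ x² / n`. Thus the second moment
alone bounds the bias caused by truncation. -/
lemma abs_clip_sub_le {n : ℝ} (hn : 0 < n) (x : ℝ) : |clip n x - x| ≤ x ^ 2 / n := by
  have hx : x = Real.sign x * |x| := by
    rcases lt_trichotomy x 0 with h | h | h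
    · rw [Real.sign_of_neg h, abs_of_neg h]; ring
    · simp [h]
    · rw [Real.sign_of_pos h, abs_of_pos h]; ring
  rcases le_total |x| n with h | h
  · rw [clip, min_eq_left h, ← hx, sub_self, abs_zero]; positivity
  · have h1 : |Real.sign x| ≤ 1 := by
      rcases Real.sign_apply_eq x with h | h | h <;> simp [h]
    have h2 : clip n x - x = Real.sign x * (n - |x|) := by
      rw [clip, min_eq_right h]; nth_rewrite 2 [hx]; ring
    rw [h2, abs_mul, abs_of_nonpos (by linarith : n - |x| ≤ 0), le_div_iff₀ hn, ← sq_abs x]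
    have h3 : |Real.sign x| * -(n - |x|) ≤ 1 * -(n - |x|) :=
      mul_le_mul_of_nonneg_right h1 (by linarith)
    nlinarith [abs_nonneg x]

lemma measurable_sign : Measurable Real.sign :=
  Measurable.ite measurableSet_Iio measurable_const
    (Measurable.ite measurableSet_Ioi measurable_const measurable_const)

lemma measurable_clip (n : ℝ) : Measurable (clip n) :=
  measurable_sign.mul ((measurable_id.abs).min measurable_const)

/-! ### The randomized threshold rule with independent `U` and `V` -/

/-- The threshold rule: `g₁`, `g₂` or `g₃` of the first coordinate, according as the second
coordinate is below `-l`, in `[-l, l]`, or above `l`. -/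
def thresholdRule (l : ℝ) (g₁ g₂ g₃ : ℝ → ℝ) (p : ℝ × ℝ) : ℝ :=
  if p.2 < -l then g₁ p.1 else if p.2 ≤ l then g₂ p.1 else g₃ p.1

lemma integral_thresholdRule {l : ℝ} (hl : 0 ≤ l) {g₁ g₂ g₃ : ℝ → ℝ} {ν : Measure ℝ}
    [IsProbabilityMeasure ν] (h₁ : Integrable g₁ ν) (h₂ : Integrable g₂ ν) (h₃ : Integrable g₃ ν) :
    Integrable (thresholdRule l g₁ g₂ g₃) (ν.prod ν) ∧
    ∫ p, thresholdRule l g₁ g₂ g₃ p ∂(ν.prod ν)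
      = ν.real (Set.Iio (-l)) * ∫ u, g₁ u ∂ν + ν.real (Set.Icc (-l) l) * ∫ u, g₂ u ∂ν
        + ν.real (Set.Ioi l) * ∫ u, g₃ u ∂ν := by
  have hone : ∀ A : Set ℝ, MeasurableSet A → Integrable (A.indicator (fun _ => (1 : ℝ))) ν :=
    fun A hA => (integrable_const 1).indicator hA
  have hi : ∀ A : Set ℝ, MeasurableSet A → ∫ v, A.indicator (fun _ => (1 : ℝ)) v ∂ν = ν.real A :=
    fun A hA => by rw [integral_indicator hA]; simp
  have e : thresholdRule l g₁ g₂ g₃ = fun p =>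
      (g₁ p.1 * (Set.Iio (-l)).indicator (fun _ => (1 : ℝ)) p.2
        + g₂ p.1 * (Set.Icc (-l) l).indicator (fun _ => (1 : ℝ)) p.2)
        + g₃ p.1 * (Set.Ioi l).indicator (fun _ => (1 : ℝ)) p.2 := by
    ext ⟨u, v⟩
    simp only [thresholdRule, Set.indicator_apply, Set.mem_Iio, Set.mem_Icc, Set.mem_Ioi]
    by_cases h1 : v < -l
    · have : ¬ l < v := by linarith
      simp [h1, this, not_le.2 h1]
    · by_cases h2 : v ≤ l
      · simp [h1, h2, not_lt.1 h1, not_lt.2 h2]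
      · simp [h1, h2, not_le.1 h2]
  have i1 := h₁.mul_prod (hone _ (measurableSet_Iio (a := -l)))
  have i2 := h₂.mul_prod (hone _ (measurableSet_Icc (a := -l) (b := l)))
  have i3 := h₃.mul_prod (hone _ (measurableSet_Ioi (a := l)))
  rw [e]
  refine ⟨(i1.add i2).add i3, ?_⟩
  beta_reduce
  rw [integral_add (f := fun p : ℝ × ℝ => _ + _) (i1.add i2) i3, integral_add i1 i2, integral_prod_mul, integral_prod_mul,
    integral_prod_mul, hi _ measurableSet_Iio, hi _ measurableSet_Icc, hi _ measurableSet_Ioi]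
  ring

/-- The probability of deciding for the wrong linear branch, weighted by its cost. -/
lemma tail_mul_hingeMean_le {l μ s : ℝ} (hl : 0 < l) (hs : 0 < s) (hs1 : s ≤ 1) :
    (gaussianReal μ (s ^ 2).toNNReal).real (Set.Iic (-l)) * (hingeMean μ + hingeMean μ ^ 2)
      ≤ 40 / l := by
  set p := (gaussianReal μ (s ^ 2).toNNReal).real (Set.Iic (-l))
  have hp1 : p ≤ 1 := measureReal_le_one
  have hp0 : 0 ≤ p := measureReal_nonneg
  have hψ := hingeMean_nonneg μ
  -- Left of `-l/2` the mean is negative and `hingeMean μ ≤ φ(μ)` is small. Right of it, `x = μ + l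
  -- ≥ l/2` and `|μ| ≤ 3 x`, so the Gaussian tail at distance `x` beats the quadratic growth in `μ`.
  rcases le_or_gt μ (-l / 2) with h | h
  · have h1 := (hingeMean_le_stdPdf (by linarith : μ ≤ 0)).trans (stdPdf_le_exp μ)
    have h2 : Real.exp (-μ ^ 2 / 2) ≤ 2 / l := by
      have h3 : Real.exp (-μ ^ 2 / 2) ≤ Real.exp (-(l ^ 2 / 8)) :=
        Real.exp_le_exp.2 (by nlinarith)
      refine h3.trans ?_
      rw [Real.exp_neg, ← one_div, div_le_div_iff₀ (Real.exp_pos _) hl]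
      nlinarith [Real.add_one_le_exp (l ^ 2 / 8), sq_nonneg (l - 2)]
    have h3 := (hingeMean_le_stdPdf (by linarith : μ ≤ 0)).trans (stdPdf_le_half μ)
    have h4 : hingeMean μ ≤ 1 / l := by
      have : (2 : ℝ) / l / 2 = 1 / l := by ring
      linarith
    have h5 : hingeMean μ + hingeMean μ ^ 2 ≤ 2 / l := by
      have : (2 : ℝ) / l = 2 * (1 / l) := by ring
      nlinarith
    calc p * (hingeMean μ + hingeMean μ ^ 2) ≤ 1 * (2 / l) := by gcongr
      _ ≤ 40 / l := by rw [one_mul]; gcongr; norm_num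
  · set x := μ + l with hx
    have hx0 : 0 < x := by linarith
    have hp := gaussianReal_tail_le (m := μ) (l := -l) hs (by linarith)
    rw [sub_neg_eq_add, ← hx] at hp
    have hxs : x ≤ x / s := by rw [le_div_iff₀ hs]; nlinarith
    have hp2 : p ≤ Real.exp (-x ^ 2 / 2) / 2 / x := by
      refine hp.trans ?_
      have h1 : stdPdf (x / s) ≤ Real.exp (-x ^ 2 / 2) / 2 := by
        refine (stdPdf_le_exp _).trans ?_
        gcongr
      have := (stdPdf_pos (x / s)).le
      gcongr
    have hμ : |μ| ≤ 3 * x := by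
      rw [abs_le]; constructor <;> linarith
    have h1 := hingeMean_le μ
    have h2 : hingeMean μ + hingeMean μ ^ 2 ≤ 20 * (1 + x ^ 2) := by
      have : hingeMean μ ≤ 1 / 2 + 3 * x := by linarith
      nlinarith [sq_nonneg (x - 1)]
    have h3 : 1 + x ^ 2 ≤ 2 * Real.exp (x ^ 2 / 2) := by
      linarith [Real.add_one_le_exp (x ^ 2 / 2), sq_nonneg x]
    have h4 : Real.exp (-x ^ 2 / 2) * Real.exp (x ^ 2 / 2) = 1 := by
      rw [← Real.exp_add]; simp; ring
    calc p * (hingeMean μ + hingeMean μ ^ 2)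
        ≤ (Real.exp (-x ^ 2 / 2) / 2 / x) * (20 * (2 * Real.exp (x ^ 2 / 2))) := by
          refine mul_le_mul hp2 (by linarith) (by positivity) (by positivity)
      _ = 20 * (Real.exp (-x ^ 2 / 2) * Real.exp (x ^ 2 / 2)) / x := by ring
      _ = 20 / x := by rw [h4, mul_one]
      _ ≤ 20 / (l / 2) := by gcongr; linarith
      _ = 40 / l := by ring

lemma tail_mul_hingeMean_neg_le {l μ s : ℝ} (hl : 0 < l) (hs : 0 < s) (hs1 : s ≤ 1) :
    (gaussianReal μ (s ^ 2).toNNReal).real (Set.Ici l) * (hingeMean (-μ) + hingeMean (-μ) ^ 2)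
      ≤ 40 / l := by
  have h := gaussianReal_map_neg (μ := -μ) (v := (s ^ 2).toNNReal)
  rw [neg_neg] at h
  rw [← h, map_measureReal_apply (by fun_prop) measurableSet_Ici]
  convert tail_mul_hingeMean_le (μ := -μ) hl hs hs1 using 3
  ext z; simp

/-- The probability that `V` lands in `[-l, l]` when its mean is far outside. -/
lemma measureReal_Icc_le {l μ s : ℝ} (hs : 0 < s) (h : l < |μ|) :
    (gaussianReal μ (s ^ 2).toNNReal).real (Set.Icc (-l) l)
      ≤ stdPdf ((|μ| - l) / s) / ((|μ| - l) / s) := by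
  rcases le_total 0 μ with h0 | h0
  · rw [abs_of_nonneg h0] at h ⊢
    exact (measureReal_mono Set.Icc_subset_Iic_self).trans (gaussianReal_tail_le hs h)
  · rw [abs_of_nonpos h0] at h ⊢
    have := gaussianReal_tail_ge (m := μ) (l := -l) hs (by linarith)
    rw [show -l - μ = -μ - l by ring] at this
    exact (measureReal_mono Set.Icc_subset_Ici_self).trans this

lemma abs_G_le {β : ℝ} (hβ0 : 0 ≤ β) (hβ1 : β ≤ 1) (μ : ℝ) : |G μ β| ≤ 1 / 2 + 2 * |μ| := by
  rw [G_eq]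
  have h1 := hingeMean_le μ
  have h2 := hingeMean_nonneg μ
  have h3 : |β * μ| ≤ |μ| := by
    rw [abs_mul, abs_of_nonneg hβ0]; nlinarith [abs_nonneg μ]
  have := abs_le.1 h3
  rw [abs_le]; constructor <;> linarith [abs_nonneg μ]

/-- Bias bound of the threshold rule. -/
def biasBound (γ₀ : ℝ) (n : ℕ) : ℝ :=
  81 / (γ₀ * √(2 * Real.log n)) + 6 * (3 * Real.log n + 2) ^ 2 * √n / n
    + 3 / √(2 * Real.log n) + 1 / n

/-- Mean squared error bound of the threshold rule. -/
def mseBound (γ₀ : ℝ) (n : ℕ) : ℝ :=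
  80 / (γ₀ * √(2 * Real.log n)) + 12 * (3 * Real.log n + 2) ^ 2 * √n
    + 2 * (1 + √(2 * Real.log n)) ^ 2 + 9 * n / √(2 * Real.log n) + 6

/-- Contribution of the middle branch when the mean is moderate. -/
lemma middle_branch_near {β : ℝ} (hβ0 : 0 ≤ β) (hβ1 : β ≤ 1) {M μ s : ℝ} {n N : ℕ} (hn : 3 ≤ n)
    (hs : 0 < s) (hv : s ^ 2 ≤ 1 / (2 * Real.exp 1)) (hM : 0 < M)
    (hMn : M ^ 2 ≤ Real.log n / Real.exp 1) (hN : N = ⌈Real.exp 1 ^ 2 * M ^ 2⌉₊)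
    (hμ : |μ| ≤ M) :
    |∫ u, (clip n (hermiteG β N (s ^ 2) u) - G μ β) ∂(gaussianReal μ (s ^ 2).toNNReal)|
      ≤ 6 * (3 * Real.log n + 2) ^ 2 * √n / n + 1 / M ∧
    ∫ u, (clip n (hermiteG β N (s ^ 2) u) - G μ β) ^ 2 ∂(gaussianReal μ (s ^ 2).toNNReal)
      ≤ 12 * (3 * Real.log n + 2) ^ 2 * √n + 2 * (1 / 2 + 2 * M) ^ 2 := by
  set ν := gaussianReal μ (s ^ 2).toNNReal
  set S := hermiteG β N (s ^ 2)
  have he := exp_one_bounds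
  have hn0 : (0 : ℝ) < n := by positivity
  have hlog : 0 ≤ Real.log n := Real.log_natCast_nonneg n
  have hSi : Integrable S ν := integrable_hermiteG β N hs
  obtain ⟨hS2i, hS2⟩ := integral_hermiteG_sq_le hβ0 hβ1 N (μ := μ) hs hv
  have hNle : (N : ℝ) + 1 ≤ 3 * Real.log n + 2 := by
    have h1 := (Nat.ceil_lt_add_one (a := Real.exp 1 ^ 2 * M ^ 2) (by positivity)).le
    rw [← hN] at h1
    have h2 : Real.exp 1 ^ 2 * M ^ 2 ≤ Real.exp 1 * Real.log n := by
      calc _ ≤ Real.exp 1 ^ 2 * (Real.log n / Real.exp 1) := by gcongr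
        _ = _ := by field_simp
    nlinarith
  -- The bound `M² ≤ log n / e` is used here: the exponential growth of the second moment reaches
  -- only `√n`, which division by the cut level `n` makes negligible.
  have hexp : Real.exp (Real.exp 1 * μ ^ 2 / 2) ≤ √n := by
    have h1 : Real.exp 1 * μ ^ 2 / 2 ≤ Real.log n / 2 := by
      have : μ ^ 2 ≤ M ^ 2 := by rw [← sq_abs μ]; gcongr
      have : Real.exp 1 * μ ^ 2 ≤ Real.exp 1 * (Real.log n / Real.exp 1) := by
        gcongr; linarith
      rw [mul_div_cancel₀ _ (by positivity)] at this
      linarith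
    refine (Real.exp_le_exp.2 h1).trans_eq ?_
    rw [Real.exp_half, Real.exp_log hn0]
  have hES : ∫ u, S u ^ 2 ∂ν ≤ 6 * (3 * Real.log n + 2) ^ 2 * √n := by
    refine hS2.trans ?_
    gcongr
  have hclipm : AEStronglyMeasurable (fun u => clip n (S u)) ν :=
    ((measurable_clip n).comp_aemeasurable hSi.aemeasurable).aestronglyMeasurable
  have hclipi : Integrable (fun u => clip n (S u)) ν :=
    hSi.mono hclipm (Eventually.of_forall fun u => abs_clip_le_abs hn0.le _)
  constructor
  · have e : ∫ u, (clip n (S u) - G μ β) ∂ν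
        = ∫ u, (clip n (S u) - S u) ∂ν + (taylorG β N μ - G μ β) := by
      rw [integral_sub hclipi (integrable_const _), integral_sub hclipi hSi,
        integral_hermiteG β N hs]
      simp
    rw [e]
    refine (abs_add_le _ _).trans (add_le_add ?_ ?_)
    · calc |∫ u, (clip n (S u) - S u) ∂ν| ≤ ∫ u, |clip n (S u) - S u| ∂ν :=
            abs_integral_le_integral_abs
        _ ≤ ∫ u, S u ^ 2 / n ∂ν :=
            integral_mono_of_nonneg (Eventually.of_forall fun u => abs_nonneg _)
              (hS2i.div_const _) (Eventually.of_forall fun u => abs_clip_sub_le hn0 _)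
        _ = (∫ u, S u ^ 2 ∂ν) / n := integral_div _ _
        _ ≤ _ := by gcongr
    · refine (abs_taylorG_sub_G_le β N hμ (by rw [hN]; exact Nat.le_ceil _)).trans ?_
      rw [Real.exp_neg, ← one_div]
      have h1 := Real.quadratic_le_exp_of_nonneg (x := 3 * M ^ 2) (by positivity)
      have h2 : M ^ 3 ≤ Real.exp (3 * M ^ 2) := by nlinarith [sq_nonneg (M - M ^ 2), sq_nonneg M]
      rw [le_div_iff₀ hM, div_mul_eq_mul_div, div_mul_eq_mul_div, div_mul_eq_mul_div,
        div_le_one (Real.exp_pos _)]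
      linarith
  · have hle : ∀ u, (clip n (S u) - G μ β) ^ 2 ≤ 2 * S u ^ 2 + 2 * (1 / 2 + 2 * M) ^ 2 := fun u => by
      have h1 : clip n (S u) ^ 2 ≤ S u ^ 2 := sq_le_sq.2 (abs_clip_le_abs hn0.le _)
      have h2 : G μ β ^ 2 ≤ (1 / 2 + 2 * M) ^ 2 := by
        rw [← sq_abs]
        have := abs_G_le hβ0 hβ1 μ
        gcongr
        linarith
      nlinarith [sq_nonneg (clip n (S u) + G μ β)]
    have hi : Integrable (fun u => 2 * S u ^ 2 + 2 * (1 / 2 + 2 * M) ^ 2) ν :=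
      (hS2i.const_mul 2).add (integrable_const _)
    calc _ ≤ ∫ u, (2 * S u ^ 2 + 2 * (1 / 2 + 2 * M) ^ 2) ∂ν :=
          integral_mono_of_nonneg (Eventually.of_forall fun u => sq_nonneg _) hi
            (Eventually.of_forall hle)
      _ = 2 * ∫ u, S u ^ 2 ∂ν + 2 * (1 / 2 + 2 * M) ^ 2 := by
          rw [integral_add (hS2i.const_mul 2) (integrable_const _), integral_const_mul,
            integral_const, probReal_univ, one_smul]
      _ ≤ _ := by linarith

/-- Contribution of the middle branch when the mean is large. -/
lemma middle_branch_far {β : ℝ} (hβ0 : 0 ≤ β) (hβ1 : β ≤ 1) {l μ s : ℝ} {n : ℕ} (hn : 3 ≤ n)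
    (hs : 0 < s) (hs1 : s ≤ 1) (hl0 : 0 ≤ l) (hl : l ≤ √(2 * Real.log n) / 2)
    (hμ : l + s * √(2 * Real.log n) ≤ |μ|) {f : ℝ → ℝ} (hf : ∀ u, |f u| ≤ n) :
    (gaussianReal μ (s ^ 2).toNNReal).real (Set.Icc (-l) l)
      * |∫ u, (f u - G μ β) ∂(gaussianReal μ (s ^ 2).toNNReal)| ≤
        3 / √(2 * Real.log n) + 1 / n ∧
    (gaussianReal μ (s ^ 2).toNNReal).real (Set.Icc (-l) l)
      * ∫ u, (f u - G μ β) ^ 2 ∂(gaussianReal μ (s ^ 2).toNNReal) ≤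
        9 * n / √(2 * Real.log n) + 4 := by
  set ν := gaussianReal μ (s ^ 2).toNNReal
  set p := ν.real (Set.Icc (-l) l)
  set t₀ := √(2 * Real.log n)
  have hn3 : (3 : ℝ) ≤ n := by exact_mod_cast hn
  have hn0 : (0 : ℝ) < n := by linarith
  have hlog : 1 ≤ Real.log n := by
    rw [Real.le_log_iff_exp_le hn0]; linarith [exp_one_bounds.2]
  have ht₀sq : t₀ ^ 2 = 2 * Real.log n := Real.sq_sqrt (by linarith)
  have ht₀1 : 1 ≤ t₀ := Real.le_sqrt_of_sq_le (by linarith)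
  have ht₀n : t₀ ≤ n := by
    have := Real.add_one_le_exp (Real.log n)
    rw [Real.exp_log hn0] at this
    nlinarith
  set t := (|μ| - l) / s with ht
  have htt₀ : t₀ ≤ t := by rw [ht, le_div_iff₀ hs]; linarith
  have ht0 : 0 < t := by linarith
  have hμt : |μ| ≤ l + t := by
    have : |μ| - l = t * s := by rw [ht]; field_simp
    nlinarith
  have hp : p ≤ stdPdf t / t := measureReal_Icc_le hs (by nlinarith)
  have hp0 : 0 ≤ p := measureReal_nonneg
  -- At `√(2 log n)` standard deviations the density is of order `1/n`, which offsets the bound `n`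
  -- on `f`. The further `1/t` of Mills' bound makes the bias vanish and the squared error `o(n)`.
  have hφ : stdPdf t ≤ 1 / (2 * n) := by
    refine (stdPdf_le_exp t).trans ?_
    have : Real.exp (-t ^ 2 / 2) ≤ 1 / n := by
      rw [one_div, ← Real.exp_log hn0, ← Real.exp_neg]
      refine Real.exp_le_exp.2 ?_
      nlinarith
    calc _ ≤ (1 / n : ℝ) / 2 := by gcongr
      _ = _ := by field_simp
  have hφt : stdPdf t * t ≤ 1 / 2 := by
    have h1 := stdPdf_le_exp t
    have h2 : Real.exp (-t ^ 2 / 2) * t ≤ 1 := by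
      rw [neg_div, Real.exp_neg, inv_mul_le_iff₀ (Real.exp_pos _)]
      nlinarith [Real.add_one_le_exp (t ^ 2 / 2), sq_nonneg (t - 1)]
    nlinarith
  have hb : ∀ u, |f u - G μ β| ≤ 3 * n + 2 * t := fun u => by
    have h1 := hf u
    have h2 := abs_G_le hβ0 hβ1 μ
    have h3 := abs_sub (f u) (G μ β)
    linarith
  have hpn : p * n ≤ 1 / (2 * t₀) := by
    calc p * n ≤ (1 / (2 * n)) / t₀ * n := by
          have := (stdPdf_pos t).le
          have : p ≤ (1 / (2 * n)) / t₀ := hp.trans (by gcongr)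
          gcongr
      _ = _ := by field_simp
  have hpt : p * t ≤ stdPdf t := by
    rw [le_div_iff₀ ht0] at hp; exact hp
  constructor
  · have h1 : |∫ u, (f u - G μ β) ∂ν| ≤ 3 * n + 2 * t := by
      have := norm_integral_le_of_norm_le_const (μ := ν) (f := fun u => f u - G μ β)
        (Eventually.of_forall hb)
      simpa using this
    calc p * |∫ u, (f u - G μ β) ∂ν| ≤ p * (3 * n + 2 * t) := by gcongr
      _ = 3 * (p * n) + 2 * (p * t) := by ring
      _ ≤ 3 * (1 / (2 * t₀)) + 2 * (1 / (2 * n)) := by linarith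
      _ ≤ 3 / t₀ + 1 / n := by
        have : 3 * (1 / (2 * t₀)) ≤ 3 / t₀ := by
          rw [mul_one_div]; gcongr; linarith
        have : 2 * (1 / (2 * n : ℝ)) = 1 / n := by field_simp
        linarith
  · have h1 : ∫ u, (f u - G μ β) ^ 2 ∂ν ≤ 2 * (3 * n) ^ 2 + 2 * (2 * t) ^ 2 := by
      have h2 : ∀ u, ‖(f u - G μ β) ^ 2‖ ≤ 2 * (3 * n) ^ 2 + 2 * (2 * t) ^ 2 := fun u => by
        rw [Real.norm_of_nonneg (sq_nonneg _), ← sq_abs]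
        have : |f u - G μ β| ^ 2 ≤ (3 * n + 2 * t) ^ 2 := by gcongr; exact hb u
        nlinarith [sq_nonneg (3 * (n : ℝ) - 2 * t)]
      have := norm_integral_le_of_norm_le_const (μ := ν) (Eventually.of_forall h2)
      simp only [probReal_univ, mul_one] at this
      exact (le_abs_self _).trans this
    calc _ ≤ p * (2 * (3 * n) ^ 2 + 2 * (2 * t) ^ 2) := by gcongr
      _ = 18 * n * (p * n) + 8 * t * (p * t) := by ring
      _ ≤ 18 * n * (1 / (2 * t₀)) + 8 * t * stdPdf t := by gcongr
      _ ≤ 9 * n / t₀ + 4 := by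
        have : 18 * n * (1 / (2 * t₀)) = 9 * n / t₀ := by field_simp; norm_num
        linarith

lemma integral_affine_sub_sq (a k μ s : ℝ) :
    Integrable (fun u => (a * u - k) ^ 2) (gaussianReal μ (s ^ 2).toNNReal) ∧
    ∫ u, (a * u - k) ^ 2 ∂(gaussianReal μ (s ^ 2).toNNReal) = a ^ 2 * s ^ 2 + (a * μ - k) ^ 2 := by
  set ν := gaussianReal μ (s ^ 2).toNNReal
  have hm : MemLp (fun u : ℝ => u) 2 ν := memLp_id_gaussianReal' 2 (by simp)
  have hm2 : MemLp (fun u => a * u - k) 2 ν := (hm.const_mul a).sub (memLp_const k)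
  have hmean : ∫ u, (a * u - k) ∂ν = a * μ - k := by
    rw [integral_sub ((integrable_id_gaussianReal _ _).const_mul a) (integrable_const _),
      integral_const_mul, integral_id_gaussianReal, integral_const, probReal_univ, one_smul]
  have hvar : Var[fun u => a * u - k; ν] = a ^ 2 * s ^ 2 := by
    rw [variance_sub_const (by fun_prop), variance_const_mul, variance_fun_id_gaussianReal,
      Real.coe_toNNReal _ (sq_nonneg s)]
  refine ⟨hm2.integrable_sq, ?_⟩
  have := variance_eq_sub hm2
  rw [hvar, hmean] at this
  simp only [Pi.pow_apply] at this
  linarith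

set_option maxHeartbeats 400000 in
/-- Bias and mean squared error of the randomized threshold rule as an estimate of `G(μ, β)`. -/
theorem thresholdRule_bounds {β : ℝ} (hβ0 : 0 ≤ β) (hβ1 : β ≤ 1) {γ₀ γ r s : ℝ} (μ : ℝ) {n N : ℕ}
    (hn : 3 ≤ n) (hγ₀ : 0 < γ₀) (hγ : γ₀ ≤ γ) (hs : 0 < s) (hsr : s ≤ r)
    (hγr : (γ + r) ^ 2 ≤ 1 / (2 * Real.exp 1))
    (hN : N = ⌈Real.exp 1 ^ 2 * (γ + r) ^ 2 * (2 * Real.log n)⌉₊) :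
    let R := thresholdRule (threshold γ n) (fun u => -β * u)
      (fun u => clip n (hermiteG β N (s ^ 2) u)) (fun u => (1 - β) * u)
    let ν := gaussianReal μ (s ^ 2).toNNReal
    Integrable R (ν.prod ν) ∧ |∫ p, R p ∂(ν.prod ν) - G μ β| ≤ biasBound γ₀ n ∧
    Integrable (fun p => (R p - G μ β) ^ 2) (ν.prod ν) ∧
    ∫ p, (R p - G μ β) ^ 2 ∂(ν.prod ν) ≤ mseBound γ₀ n := by
  intro R ν
  set t₀ := √(2 * Real.log n) with ht₀
  have he := exp_one_bounds
  have hn3 : (3 : ℝ) ≤ n := by exact_mod_cast hn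
  have hn0 : (0 : ℝ) < n := by linarith
  have hlog : 1 ≤ Real.log n := by
    rw [Real.le_log_iff_exp_le hn0]; linarith
  have ht₀sq : t₀ ^ 2 = 2 * Real.log n := Real.sq_sqrt (by linarith)
  have ht₀1 : 1 ≤ t₀ := Real.le_sqrt_of_sq_le (by linarith)
  have hγ0 : 0 < γ := by linarith
  have hr0 : 0 < r := by linarith
  have h2e : 1 / (2 * Real.exp 1) ≤ 1 / 4 := by gcongr; linarith
  have hγr2 : γ + r ≤ 1 / 2 :=
    (sq_le_sq₀ (by linarith) (by norm_num)).1 (by norm_num at h2e hγr ⊢; linarith)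
  have hs1 : s ≤ 1 := by linarith
  have hv : s ^ 2 ≤ 1 / (2 * Real.exp 1) :=
    (pow_le_pow_left₀ hs.le (by linarith) 2).trans hγr
  set l := threshold γ n with hl
  have hl0 : 0 < l := by rw [hl, threshold]; positivity
  have hll : γ₀ * t₀ ≤ l := by rw [hl, threshold]; gcongr
  have hlt : l ≤ t₀ / 2 := by
    have : γ * t₀ ≤ 1 / 2 * t₀ := by gcongr; linarith
    rw [hl, threshold]; linarith
  -- `M = l + r t₀` with `r ≥ s`: beyond `M` the mean is at least `t₀` standard deviations away from
  -- `[-l, l]`.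
  set M := (γ + r) * t₀ with hMdef
  have hM0 : 0 < M := by positivity
  have hMsq : M ^ 2 = (γ + r) ^ 2 * (2 * Real.log n) := by rw [hMdef, mul_pow, ht₀sq]
  have hMn : M ^ 2 ≤ Real.log n / Real.exp 1 := by
    rw [hMsq]
    calc _ ≤ 1 / (2 * Real.exp 1) * (2 * Real.log n) := by gcongr
      _ = _ := by field_simp
  rw [mul_assoc, ← hMsq] at hN
  have hMl : l ≤ M := by rw [hl, hMdef, threshold]; gcongr; linarith
  have hM2 : 2 * M ≤ t₀ := by
    have : (γ + r) * t₀ ≤ 1 / 2 * t₀ := by gcongr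
    linarith
  set f : ℝ → ℝ := fun u => clip n (hermiteG β N (s ^ 2) u)
  have hfi : Integrable f ν := by
    have h := integrable_hermiteG β N (μ := μ) hs
    exact h.mono ((measurable_clip n).comp_aemeasurable h.aemeasurable).aestronglyMeasurable
      (Eventually.of_forall fun u => abs_clip_le_abs hn0.le _)
  have hfn : ∀ u, |f u| ≤ n := fun u => abs_clip_le hn0.le _
  have hf2i : Integrable (fun u => (f u - G μ β) ^ 2) ν := by
    have hb : MemLp (fun u => f u - G μ β) 2 ν := by
      refine (MemLp.of_bound hfi.aestronglyMeasurable n (Eventually.of_forall hfn)).sub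
        (memLp_const _)
    exact hb.integrable_sq
  have hid := integrable_id_gaussianReal μ (s ^ 2).toNNReal
  -- the linear branches
  have hp0 : ∀ A : Set ℝ, 0 ≤ ν.real A := fun A => measureReal_nonneg
  have hp1 : ∀ A : Set ℝ, ν.real A ≤ 1 := fun A => measureReal_le_one
  have hL : ν.real (Set.Iio (-l)) * (hingeMean μ + hingeMean μ ^ 2) ≤ 40 / (γ₀ * t₀) := by
    have h1 := tail_mul_hingeMean_le (μ := μ) hl0 hs hs1
    have h2 : ν.real (Set.Iio (-l)) ≤ ν.real (Set.Iic (-l)) := measureReal_mono Set.Iio_subset_Iic_self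
    have h3 := hingeMean_nonneg μ
    calc _ ≤ ν.real (Set.Iic (-l)) * (hingeMean μ + hingeMean μ ^ 2) := by gcongr
      _ ≤ 40 / l := h1
      _ ≤ _ := by gcongr
  have hRt : ν.real (Set.Ioi l) * (hingeMean (-μ) + hingeMean (-μ) ^ 2) ≤ 40 / (γ₀ * t₀) := by
    have h1 := tail_mul_hingeMean_neg_le (μ := μ) hl0 hs hs1
    have h2 : ν.real (Set.Ioi l) ≤ ν.real (Set.Ici l) := measureReal_mono Set.Ioi_subset_Ici_self
    have h3 := hingeMean_nonneg (-μ)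
    calc _ ≤ ν.real (Set.Ici l) * (hingeMean (-μ) + hingeMean (-μ) ^ 2) := by gcongr
      _ ≤ 40 / l := h1
      _ ≤ _ := by gcongr
  -- the middle branch
  have hmid : ν.real (Set.Icc (-l) l) * |∫ u, (f u - G μ β) ∂ν|
        ≤ 6 * (3 * Real.log n + 2) ^ 2 * √n / n + 1 / (γ₀ * t₀) + 3 / t₀ + 1 / n ∧
      ν.real (Set.Icc (-l) l) * ∫ u, (f u - G μ β) ^ 2 ∂ν
        ≤ 12 * (3 * Real.log n + 2) ^ 2 * √n + 2 * (1 + t₀) ^ 2 + 9 * n / t₀ + 4 := by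
    have hpos1 : 0 ≤ 6 * (3 * Real.log n + 2) ^ 2 * √n / n := by positivity
    have hpos2 : 0 ≤ 1 / (γ₀ * t₀) := by positivity
    have hpos3 : 0 ≤ 3 / t₀ + 1 / n := by positivity
    have hpos4 : 0 ≤ 9 * n / t₀ := by positivity
    have hpos5 : 0 ≤ 12 * (3 * Real.log n + 2) ^ 2 * √n := by positivity
    have hpos6 : 0 ≤ 2 * (1 + t₀) ^ 2 := by positivity
    rcases le_or_gt |μ| M with h | h
    · obtain ⟨h1, h2⟩ := middle_branch_near hβ0 hβ1 hn hs hv hM0 hMn hN h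
      constructor
      · calc _ ≤ 1 * |∫ u, (f u - G μ β) ∂ν| := by gcongr; exact hp1 _
          _ ≤ 6 * (3 * Real.log n + 2) ^ 2 * √n / n + 1 / M := by rw [one_mul]; exact h1
          _ ≤ 6 * (3 * Real.log n + 2) ^ 2 * √n / n + 1 / (γ₀ * t₀) := by
            gcongr; exact hll.trans hMl
          _ ≤ _ := by linarith
      · calc _ ≤ 1 * ∫ u, (f u - G μ β) ^ 2 ∂ν :=
              mul_le_mul_of_nonneg_right (hp1 _) (integral_nonneg fun u => sq_nonneg _)
          _ ≤ 12 * (3 * Real.log n + 2) ^ 2 * √n + 2 * (1 / 2 + 2 * M) ^ 2 := by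
            rw [one_mul]; exact h2
          _ ≤ 12 * (3 * Real.log n + 2) ^ 2 * √n + 2 * (1 + t₀) ^ 2 := by gcongr; norm_num
          _ ≤ _ := by linarith
    · have hfar : l + s * t₀ ≤ |μ| := by
        have : l + s * t₀ ≤ M := by
          rw [hl, hMdef, threshold, add_mul]; gcongr
        linarith
      obtain ⟨h1, h2⟩ := middle_branch_far hβ0 hβ1 hn hs hs1 hl0.le hlt hfar hfn
      exact ⟨h1.trans (by linarith), h2.trans (by linarith)⟩
  have hψ := hingeMean_nonneg μ
  have hψ' := hingeMean_nonneg (-μ)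
  -- The lines `-β μ` and `(1 - β) μ` are the asymptotes of `G` at `∓∞`; the distances to `G` are
  -- `hingeMean μ` and `hingeMean (-μ)`.
  have hG1 : -β * μ - G μ β = -hingeMean μ := by rw [G_eq]; ring
  have hG3 : (1 - β) * μ - G μ β = -hingeMean (-μ) := by
    rw [G_eq]; linarith [hingeMean_sub_neg μ]
  have h1i : ∀ a : ℝ, Integrable (fun u => a * u) ν := fun a => hid.const_mul a
  have hmean : ∀ a : ℝ, ∫ u, (a * u - G μ β) ∂ν = a * μ - G μ β := fun a => by
    rw [integral_sub (h1i a) (integrable_const _), integral_const_mul, integral_id_gaussianReal,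
      integral_const, probReal_univ, one_smul]
  obtain ⟨hRi, -⟩ := integral_thresholdRule hl0.le (h1i (-β)) hfi (h1i (1 - β))
  -- Exactly one branch is active, so subtracting the target or squaring acts branch by branch; bias
  -- and squared error then split by `integral_thresholdRule`.
  have hR1 : (fun p => R p - G μ β) = thresholdRule l (fun u => -β * u - G μ β)
      (fun u => f u - G μ β) (fun u => (1 - β) * u - G μ β) := by
    ext p; simp only [R, thresholdRule]; split_ifs <;> rfl
  have hR2 : (fun p => (R p - G μ β) ^ 2) = thresholdRule l (fun u => (-β * u - G μ β) ^ 2)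
      (fun u => (f u - G μ β) ^ 2) (fun u => ((1 - β) * u - G μ β) ^ 2) := by
    ext p; simp only [R, thresholdRule]; split_ifs <;> rfl
  obtain ⟨-, hI1⟩ := integral_thresholdRule hl0.le ((h1i (-β)).sub (integrable_const (G μ β)))
    (hfi.sub (integrable_const (G μ β))) ((h1i (1 - β)).sub (integrable_const (G μ β)))
  have hI1' : ∫ p, R p ∂(ν.prod ν) - G μ β = ν.real (Set.Iio (-l)) * -hingeMean μ
      + ν.real (Set.Icc (-l) l) * ∫ u, (f u - G μ β) ∂ν
      + ν.real (Set.Ioi l) * -hingeMean (-μ) := by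
    have e : ∫ p, (R p - G μ β) ∂(ν.prod ν) = ∫ p, R p ∂(ν.prod ν) - G μ β := by
      rw [integral_sub hRi (integrable_const _), integral_const, probReal_univ, one_smul]
    rw [← e, hR1, ← hG1, ← hG3, ← hmean (-β), ← hmean (1 - β)]
    exact hI1
  obtain ⟨hI2i, hI2⟩ := integral_thresholdRule hl0.le (integral_affine_sub_sq (-β) (G μ β) μ s).1
    hf2i (integral_affine_sub_sq (1 - β) (G μ β) μ s).1
  refine ⟨hRi, ?_, ?_, ?_⟩
  · rw [hI1']
    have ha : |ν.real (Set.Iio (-l)) * -hingeMean μ| ≤ 40 / (γ₀ * t₀) := by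
      rw [abs_mul, abs_neg, abs_of_nonneg (hp0 _), abs_of_nonneg hψ]
      exact (mul_le_mul_of_nonneg_left (by linarith [sq_nonneg (hingeMean μ)]) (hp0 _)).trans hL
    have hb : |ν.real (Set.Ioi l) * -hingeMean (-μ)| ≤ 40 / (γ₀ * t₀) := by
      rw [abs_mul, abs_neg, abs_of_nonneg (hp0 _), abs_of_nonneg hψ']
      exact (mul_le_mul_of_nonneg_left (by linarith [sq_nonneg (hingeMean (-μ))]) (hp0 _)).trans hRt
    have hc := hmid.1
    rw [← abs_of_nonneg (hp0 (Set.Icc (-l) l)), ← abs_mul] at hc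
    refine (abs_add_three _ _ _).trans ?_
    have e1 : 81 / (γ₀ * t₀) = 40 / (γ₀ * t₀) + 40 / (γ₀ * t₀) + 1 / (γ₀ * t₀) := by ring
    rw [biasBound, ← ht₀, e1]
    linarith
  · rw [hR2]; exact hI2i
  · rw [hR2, hI2, (integral_affine_sub_sq _ _ _ _).2, (integral_affine_sub_sq _ _ _ _).2, hG1, hG3,
      neg_sq, neg_sq]
    have hlin : ∀ (A : Set ℝ) (a ψ : ℝ), a ^ 2 ≤ 1 → 0 ≤ ψ → ν.real A * (ψ + ψ ^ 2) ≤ 40 / (γ₀ * t₀) →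
        ν.real A * (a ^ 2 * s ^ 2 + ψ ^ 2) ≤ 1 + 40 / (γ₀ * t₀) := fun A a ψ ha hψ h => by
      have h0 : s ^ 2 ≤ 1 := pow_le_one₀ hs.le hs1
      have h1 : a ^ 2 * s ^ 2 ≤ 1 := mul_le_one₀ ha (sq_nonneg s) h0
      have h2 : ν.real A * (a ^ 2 * s ^ 2) ≤ 1 := mul_le_one₀ (hp1 A) (by positivity) h1
      have h3 := mul_nonneg (hp0 A) hψ
      rw [mul_add] at h ⊢
      linarith
    have ha := hlin (Set.Iio (-l)) β _ (pow_le_one₀ hβ0 hβ1) hψ hL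
    have hb := hlin (Set.Ioi l) (1 - β) _ (pow_le_one₀ (by linarith) (by linarith)) hψ' hRt
    have hc := hmid.2
    have e1 : 80 / (γ₀ * t₀) = 40 / (γ₀ * t₀) + 40 / (γ₀ * t₀) := by ring
    rw [mseBound, ← ht₀, e1, neg_sq]
    linarith

/-! ### Parameters of one coordinate and the law of the pair `(U, V)` -/

namespace Coord

variable (P : Coord)

/-- The hypotheses of the problem on one coordinate and its threshold multiplier. -/
structure Admissible (P : Coord) (γ₀ γ : ℝ) : Prop where
  b_pos : 0 < P.b
  h_pos : 0 < P.h
  σp_pos : 0 < (P.σp : ℝ)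
  σf_pos : 0 < (P.σf : ℝ)
  γ₀_pos : 0 < γ₀
  γ₀_le : γ₀ ≤ γ
  γ_lt : γ < 1 / √(4 * Real.exp 1) - √(P.σp / P.σf)

lemma alpha_nonneg (τ : ℝ≥0∞) : 0 ≤ P.alpha τ := by
  unfold alpha; split_ifs
  · exact zero_le_one
  · positivity

lemma alpha_le_one (τ : ℝ≥0∞) : P.alpha τ ≤ 1 := by
  unfold alpha; split_ifs
  · exact le_rfl
  · exact div_le_one_of_le₀ (by simp) (by positivity)

lemma alpha_lt_one (hσ : 0 < (P.σp : ℝ)) {τ : ℝ≥0∞} (hτ : τ ≠ ∞) : P.alpha τ < 1 := by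
  have : 0 ≤ τ.toReal := ENNReal.toReal_nonneg
  rw [alpha, if_neg hτ, div_lt_one (by linarith)]
  linarith

lemma measurable_alpha : Measurable P.alpha :=
  Measurable.ite (measurableSet_singleton _) measurable_const
    (ENNReal.measurable_toReal.div (ENNReal.measurable_toReal.add_const _))

variable {P}

lemma Admissible.ratio_mem {γ₀ γ : ℝ} (h : P.Admissible γ₀ γ) : 0 ≤ P.ratio ∧ P.ratio ≤ 1 := by
  have := h.b_pos
  have := h.h_pos
  exact ⟨by unfold ratio; positivity, div_le_one_of_le₀ (by linarith) (by linarith)⟩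

/-- With `q = √(σp/σf)`, `γ + √2 q ≤ √2 (γ + q) ≤ √2 / √(4e) = 1/√(2e)`. This is what the constant
`1/(4e)` in the assumptions provides. -/
lemma Admissible.sq_le {γ₀ γ : ℝ} (h : P.Admissible γ₀ γ) :
    (γ + √(2 * (P.σp / P.σf))) ^ 2 ≤ 1 / (2 * Real.exp 1) := by
  have h0 := h.γ₀_pos
  have h1 := h.γ₀_le
  have h2 := h.γ_lt
  set q := √(P.σp / P.σf : ℝ)
  have hq : 0 ≤ q := Real.sqrt_nonneg _
  have h3 : √(2 * (P.σp / P.σf : ℝ)) = √2 * q := Real.sqrt_mul (by norm_num) _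
  have h4 : (1 : ℝ) ≤ √2 := Real.one_le_sqrt.2 (by norm_num)
  have h5 : γ + √2 * q ≤ √2 * (1 / √(4 * Real.exp 1)) := by
    have : γ ≤ √2 * γ := le_mul_of_one_le_left (by linarith) h4
    have : √2 * (γ + q) ≤ √2 * (1 / √(4 * Real.exp 1)) := by gcongr; linarith
    linarith
  have h6 : 0 ≤ γ + √2 * q := add_nonneg (by linarith) (by positivity)
  rw [h3]
  refine (pow_le_pow_left₀ h6 h5 2).trans_eq ?_
  rw [mul_pow, div_pow, Real.sq_sqrt (by norm_num), Real.sq_sqrt (by positivity)]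
  field_simp
  norm_num

/-- The standard deviation of `c + d (X + √σp Z)`. -/
def sd (P : Coord) (τ : ℝ≥0∞) : ℝ := √(2 * P.σp) * |P.d τ|

lemma sd_sq (P : Coord) (τ : ℝ≥0∞) : P.sd τ ^ 2 = 2 * P.σp * P.d τ ^ 2 := by
  rw [sd, mul_pow, Real.sq_sqrt (by positivity), sq_abs]

/-- At `τ = ∞` the slope `d` vanishes and the law of `U` degenerates; for the `n` considered later,
all grid points are finite. -/
lemma Admissible.sd_pos {γ₀ γ : ℝ} (h : P.Admissible γ₀ γ) {τ : ℝ≥0∞} (hτ : τ ≠ ∞) :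
    0 < P.sd τ := by
  have h1 := P.alpha_lt_one h.σp_pos hτ
  have h2 := h.σp_pos
  have h3 := h.σf_pos
  have hd : P.d τ ≠ 0 := by
    rw [d]
    exact div_ne_zero (by linarith) (Real.sqrt_pos.2 (by positivity)).ne'
  exact mul_pos (Real.sqrt_pos.2 (by linarith)) (abs_pos.2 hd)

/-- The bound is free of `τ`, as is needed for a truncation order that does not depend on `τ`. -/
lemma Admissible.sd_le {γ₀ γ : ℝ} (h : P.Admissible γ₀ γ) (τ : ℝ≥0∞) :
    P.sd τ ≤ √(2 * (P.σp / P.σf)) := by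
  have h2 := h.σp_pos
  have h3 := h.σf_pos
  refine Real.le_sqrt_of_sq_le ?_
  rw [sd_sq, d, div_pow, Real.sq_sqrt (by positivity), neg_sq, mul_assoc]
  have h4 : (1 - P.alpha τ) ^ 2 ≤ 1 :=
    pow_le_one₀ (by linarith [P.alpha_le_one τ]) (by linarith [P.alpha_nonneg τ])
  have h5 : (1 - P.alpha τ) ^ 2 / (P.σf + P.alpha τ ^ 2 * P.σp) ≤ 1 / P.σf := by
    gcongr
    exact le_add_of_nonneg_right (by positivity)
  calc 2 * ((P.σp : ℝ) * ((1 - P.alpha τ) ^ 2 / (P.σf + P.alpha τ ^ 2 * P.σp)))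
      ≤ 2 * (P.σp * (1 / P.σf)) := by gcongr
    _ = _ := by ring

/-- The pair `(U, V)` consists of independent `N(c + d θ, v)` variables. -/
lemma map_pair (P : Coord) (τ : ℝ≥0∞) (θ : ℝ) :
    ((gaussianReal θ P.σp).prod (gaussianReal 0 1)).map
        (fun p => (P.c τ + P.d τ * (p.1 + √P.σp * p.2), P.c τ + P.d τ * (p.1 - √P.σp * p.2)))
      = (gaussianReal (P.c τ + P.d τ * θ) (P.sd τ ^ 2).toNNReal).prod
          (gaussianReal (P.c τ + P.d τ * θ) (P.sd τ ^ 2).toNNReal) := by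
  have h1 : (gaussianReal θ (2 * P.σp)).map (fun x => P.c τ + P.d τ * x)
      = gaussianReal (P.c τ + P.d τ * θ) (P.sd τ ^ 2).toNNReal := by
    have h : (fun x : ℝ => P.c τ + P.d τ * x) = (fun x => P.c τ + x) ∘ fun x => P.d τ * x := rfl
    rw [h, ← Measure.map_map (by fun_prop) (by fun_prop), gaussianReal_map_const_mul,
      gaussianReal_map_const_add]
    congr 1
    · ring
    · ext
      rw [Real.coe_toNNReal _ (sq_nonneg _), sd_sq]
      simp; ring
  rw [← h1, Measure.map_prod_map _ _ (by fun_prop) (by fun_prop), ← map_add_sub_gaussianReal,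
    Measure.map_map (by fun_prop) (by fun_prop)]
  rfl

lemma Trand_eq (P : Coord) (γ : ℝ) (n : ℕ) (τ : ℝ≥0∞) (x z : ℝ) :
    P.Trand γ n τ x z = thresholdRule (threshold γ n) (fun u => -P.ratio * u)
      (fun u => clip n (hermiteG P.ratio (P.order γ n - 1) (P.sd τ ^ 2) u))
      (fun u => (1 - P.ratio) * u)
      (P.c τ + P.d τ * (x + √P.σp * z), P.c τ + P.d τ * (x - √P.σp * z)) := by
  rw [sd_sq]; rfl

end Coord

/-! ### Bias and mean squared error after averaging over the noise -/

lemma measurable_scaledHermite (k : ℕ) (v : ℝ) : Measurable (scaledHermite k v) := by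
  unfold scaledHermite
  split_ifs
  · fun_prop
  · simp only [aeval_hermite]
    exact (((hermiteReal k).continuous.comp (by fun_prop)).const_mul _).measurable

lemma measurable_hermiteG (β : ℝ) (N : ℕ) (v : ℝ) : Measurable (hermiteG β N v) := by
  unfold hermiteG
  refine ((measurable_const.add (measurable_id.const_mul _))).add
    (Measurable.const_mul (Finset.measurable_sum _ fun k _ => ?_) _)
  exact (measurable_scaledHermite _ _).const_mul _

lemma measurable_thresholdRule (l : ℝ) {g₁ g₂ g₃ : ℝ → ℝ} (h₁ : Measurable g₁)
    (h₂ : Measurable g₂) (h₃ : Measurable g₃) : Measurable (thresholdRule l g₁ g₂ g₃) :=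
  Measurable.ite (measurableSet_lt measurable_snd measurable_const) (h₁.comp measurable_fst)
    (Measurable.ite (measurableSet_le measurable_snd measurable_const) (h₂.comp measurable_fst)
      (h₃.comp measurable_fst))

lemma sq_integral_le {Ω : Type*} {mΩ : MeasurableSpace Ω} {μ : Measure Ω} [IsProbabilityMeasure μ]
    {f : Ω → ℝ} (hf : AEStronglyMeasurable f μ) (hf2 : Integrable (fun x => f x ^ 2) μ) :
    (∫ x, f x ∂μ) ^ 2 ≤ ∫ x, f x ^ 2 ∂μ := by
  have h := variance_eq_sub ((memLp_two_iff_integrable_sq hf).2 hf2)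
  have h0 := variance_nonneg f μ
  simp only [Pi.pow_apply] at h
  linarith

namespace Coord

variable {P : Coord}

lemma measurable_Trand (P : Coord) (γ : ℝ) (n : ℕ) (τ : ℝ≥0∞) :
    Measurable (fun p : ℝ × ℝ => P.Trand γ n τ p.1 p.2) := by
  simp only [Trand_eq]
  exact (measurable_thresholdRule _ (by fun_prop)
    ((measurable_clip _).comp (measurable_hermiteG _ _ _)) (by fun_prop)).comp (by fun_prop)

lemma measurable_T (P : Coord) (γ : ℝ) (n : ℕ) (τ : ℝ≥0∞) : Measurable (P.T γ n τ) :=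
  ((measurable_Trand P γ n τ).stronglyMeasurable.integral_prod_right').measurable

/-- Bias and mean squared error of `T` as an estimate of `G(c + d θ)`. -/
theorem Admissible.T_bounds {γ₀ γ : ℝ} (h : P.Admissible γ₀ γ) {n : ℕ} (hn : 3 ≤ n) {τ : ℝ≥0∞}
    (hτ : τ ≠ ∞) (θ : ℝ) :
    MemLp (P.T γ n τ) 2 (gaussianReal θ P.σp) ∧
    |∫ x, P.T γ n τ x ∂(gaussianReal θ P.σp) - G (P.c τ + P.d τ * θ) P.ratio| ≤ biasBound γ₀ n ∧
    ∫ x, (P.T γ n τ x - G (P.c τ + P.d τ * θ) P.ratio) ^ 2 ∂(gaussianReal θ P.σp)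
      ≤ mseBound γ₀ n := by
  set g := G (P.c τ + P.d τ * θ) P.ratio
  set κ := gaussianReal θ P.σp
  obtain ⟨hR, hbias, hR2, hmse⟩ := thresholdRule_bounds h.ratio_mem.1 h.ratio_mem.2
    (P.c τ + P.d τ * θ) hn h.γ₀_pos h.γ₀_le (h.sd_pos hτ) (h.sd_le τ) h.sq_le
    (N := P.order γ n - 1) (by simp [order])
  have hmap : AEMeasurable (fun p : ℝ × ℝ => (P.c τ + P.d τ * (p.1 + √P.σp * p.2),
      P.c τ + P.d τ * (p.1 - √P.σp * p.2))) (κ.prod (gaussianReal 0 1)) := by fun_prop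
  rw [← map_pair P τ θ] at hR hbias hR2 hmse
  rw [integral_map hmap hR.aestronglyMeasurable] at hbias
  rw [integral_map hmap hR2.aestronglyMeasurable] at hmse
  rw [integrable_map_measure hR.aestronglyMeasurable hmap] at hR
  rw [integrable_map_measure hR2.aestronglyMeasurable hmap] at hR2
  simp only [Function.comp_def, ← Trand_eq] at hR hbias hR2 hmse
  -- `T` is the conditional mean of `Trand` given `x`: by Jensen's inequality averaging cannot
  -- increase the squared error, and by Fubini it keeps the bias.
  have hT : ∀ᵐ x ∂κ, (P.T γ n τ x - g) ^ 2 ≤ ∫ z, (P.Trand γ n τ x z - g) ^ 2 ∂(gaussianReal 0 1) := by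
    filter_upwards [hR.prod_right_ae, hR2.prod_right_ae] with x h1 h2
    have e : P.T γ n τ x - g = ∫ z, (P.Trand γ n τ x z - g) ∂(gaussianReal 0 1) := by
      rw [integral_sub h1 (integrable_const _), integral_const, probReal_univ, one_smul]; rfl
    rw [e]
    exact sq_integral_le (h1.sub (integrable_const _)).aestronglyMeasurable h2
  have hm : Measurable (fun x => P.T γ n τ x - g) := (measurable_T P γ n τ).sub_const g
  have hi : Integrable (fun x => (P.T γ n τ x - g) ^ 2) κ := by
    refine hR2.integral_prod_left.mono' (hm.pow_const 2).aestronglyMeasurable ?_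
    filter_upwards [hT] with x hx
    rwa [Real.norm_of_nonneg (sq_nonneg _)]
  have hL : MemLp (fun x => P.T γ n τ x - g) 2 κ :=
    (memLp_two_iff_integrable_sq hm.aestronglyMeasurable).2 hi
  refine ⟨?_, ?_, ?_⟩
  · have := hL.add (memLp_const g)
    refine this.congr_norm ((measurable_T P γ n τ).aestronglyMeasurable)
      (Eventually.of_forall fun x => by simp)
  · rw [integral_prod _ hR] at hbias
    exact hbias
  · refine (integral_mono_ae hi hR2.integral_prod_left hT).trans ?_
    rw [← integral_prod _ hR2]
    exact hmse

end Coord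

/-! ### The predictive check loss -/

lemma integrable_posPart_gaussianReal (m : ℝ) (v : ℝ≥0) :
    Integrable (fun y => max y 0) (gaussianReal m v) :=
  (integrable_id_gaussianReal m v).sup (integrable_const 0)

lemma integrable_negPart_gaussianReal (m : ℝ) (v : ℝ≥0) :
    Integrable (fun y => max (-y) 0) (gaussianReal m v) :=
  (integrable_id_gaussianReal m v).neg.sup (integrable_const 0)

/-- The check loss of the error `y`. -/
def checkFun (b h y : ℝ) : ℝ := b * max y 0 + h * max (-y) 0

lemma integrable_checkFun (b h m : ℝ) (v : ℝ≥0) : Integrable (checkFun b h) (gaussianReal m v) :=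
  ((integrable_posPart_gaussianReal m v).const_mul b).add
    ((integrable_negPart_gaussianReal m v).const_mul h)

lemma abs_checkFun_sub_le {b h : ℝ} (hb : 0 ≤ b) (hh : 0 ≤ h) (x y : ℝ) :
    |checkFun b h x - checkFun b h y| ≤ (b + h) * |x - y| := by
  have h1 : |max x 0 - max y 0| ≤ |x - y| := abs_max_sub_max_le_abs x y 0
  have h2 : |max (-x) 0 - max (-y) 0| ≤ |x - y| := by
    have := abs_max_sub_max_le_abs (-x) (-y) 0
    rwa [show -x - -y = -(x - y) by ring, abs_neg] at this
  calc |checkFun b h x - checkFun b h y|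
      = |b * (max x 0 - max y 0) + h * (max (-x) 0 - max (-y) 0)| := by
        unfold checkFun; congr 1; ring
    _ ≤ |b * (max x 0 - max y 0)| + |h * (max (-x) 0 - max (-y) 0)| := abs_add_le _ _
    _ = b * |max x 0 - max y 0| + h * |max (-x) 0 - max (-y) 0| := by
        rw [abs_mul, abs_mul, abs_of_nonneg hb, abs_of_nonneg hh]
    _ ≤ b * |x - y| + h * |x - y| := by gcongr
    _ = _ := by ring

lemma continuous_checkFun (b h : ℝ) : Continuous (checkFun b h) := by
  unfold checkFun; fun_prop

/-- Standardizing with `w = -m/s` leaves `b hingeMean (-w) + h hingeMean w`, and `hingeMean (-w) =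
hingeMean w - w` turns this into a multiple of `G`. -/
lemma integral_checkFun {b h : ℝ} (hbh : 0 < b + h) (m : ℝ) {s : ℝ} (hs : 0 < s) :
    ∫ y, checkFun b h y ∂(gaussianReal m (s ^ 2).toNNReal)
      = (b + h) * s * G (-m / s) (b / (b + h)) := by
  rw [← gaussianReal_map_affine, integral_map (by fun_prop)
    (continuous_checkFun b h).aestronglyMeasurable]
  set w := -m / s with hw
  have hm : m = -(s * w) := by rw [hw]; field_simp
  have e : ∀ z, checkFun b h (m + s * z) = s * (b * max (z - w) 0 + h * max (w - z) 0) := fun z => by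
    have h1 : max (m + s * z) 0 = s * max (z - w) 0 := by
      rw [mul_max_of_nonneg _ _ hs.le, hm]; ring_nf
    have h2 : max (-(m + s * z)) 0 = s * max (w - z) 0 := by
      rw [mul_max_of_nonneg _ _ hs.le, hm]; ring_nf
    rw [checkFun, h1, h2]; ring
  simp only [e]
  have hi : Integrable (fun z => max (z - w) 0) (gaussianReal 0 1) :=
    ((integrable_id_gaussianReal 0 1).sub (integrable_const w)).sup (integrable_const 0)
  rw [integral_const_mul, integral_add (hi.const_mul b) ((integrable_hinge _ _ _).const_mul h),
    integral_const_mul, integral_const_mul, integral_hinge, integral_hinge_neg, G_eq]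
  have := hingeMean_sub_neg w
  have h3 : hingeMean (-w) = hingeMean w - w := by linarith
  rw [h3]
  field_simp
  ring

namespace Coord

variable {P : Coord}

lemma loss_eq (P : Coord) (θ q : ℝ) :
    P.loss θ q = ∫ y, checkFun P.b P.h (y + -q) ∂(gaussianReal θ P.σf) := by
  unfold loss checkFun
  congr 1; ext y; ring_nf

lemma integrable_checkFun_add (b h m q : ℝ) (v : ℝ≥0) :
    Integrable (fun y => checkFun b h (y + q)) (gaussianReal m v) := by
  have h1 := integrable_checkFun b h (m + q) v
  rw [← gaussianReal_map_add_const] at h1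
  exact (integrable_map_measure (continuous_checkFun b h).aestronglyMeasurable (by fun_prop)).1 h1

lemma abs_loss_sub_le (hb : 0 ≤ P.b) (hh : 0 ≤ P.h) (θ q q' : ℝ) :
    |P.loss θ q - P.loss θ q'| ≤ (P.b + P.h) * |q - q'| := by
  rw [loss_eq, loss_eq, ← integral_sub (integrable_checkFun_add _ _ _ _ _)
    (integrable_checkFun_add _ _ _ _ _)]
  have := norm_integral_le_of_norm_le_const (μ := gaussianReal θ P.σf)
    (f := fun y => checkFun P.b P.h (y + -q) - checkFun P.b P.h (y + -q'))
    (C := (P.b + P.h) * |q - q'|) (Eventually.of_forall fun y => by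
      refine (abs_checkFun_sub_le hb hh _ _).trans_eq ?_
      rw [show y + -q - (y + -q') = -(q - q') by ring, abs_neg])
  simpa using this

lemma continuous_loss (hb : 0 ≤ P.b) (hh : 0 ≤ P.h) (θ : ℝ) : Continuous (P.loss θ) := by
  have : LipschitzWith (P.b + P.h).toNNReal (P.loss θ) := LipschitzWith.of_dist_le_mul fun q q' => by
    rw [Real.dist_eq, Real.dist_eq, Real.coe_toNNReal _ (add_nonneg hb hh)]
    exact abs_loss_sub_le hb hh θ q q'
  exact this.continuous

/-- As `0 ≤ α ≤ 1`, the loss is `(b + h)`-Lipschitz in the observation, so its fluctuation about the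
value at `m` is controlled by the variance. -/
lemma memLp_loss_qhat (hb : 0 ≤ P.b) (hh : 0 ≤ P.h) (τ : ℝ≥0∞) (θ m : ℝ) (v : ℝ≥0) :
    MemLp (fun x => P.loss θ (P.qhat τ x)) 2 (gaussianReal m v) ∧
    ∫ x, (P.loss θ (P.qhat τ x) - P.loss θ (P.qhat τ m)) ^ 2 ∂(gaussianReal m v)
      ≤ (P.b + P.h) ^ 2 * v := by
  have hbd : ∀ x, |P.loss θ (P.qhat τ x) - P.loss θ (P.qhat τ m)| ≤ (P.b + P.h) * |x - m| :=
    fun x => by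
      refine (abs_loss_sub_le hb hh _ _ _).trans ?_
      rw [qhat, qhat, show P.alpha τ * x + √(P.σf + P.alpha τ * P.σp) * stdQuantile P.ratio
        - (P.alpha τ * m + √(P.σf + P.alpha τ * P.σp) * stdQuantile P.ratio)
        = P.alpha τ * (x - m) by ring, abs_mul, abs_of_nonneg (P.alpha_nonneg τ)]
      have := mul_le_of_le_one_left (abs_nonneg (x - m)) (P.alpha_le_one τ)
      have := add_nonneg hb hh
      gcongr
  have hx : MemLp (fun x : ℝ => x - m) 2 (gaussianReal m v) :=
    (memLp_id_gaussianReal' 2 (by simp)).sub (memLp_const m)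
  have hc : Continuous fun x => P.loss θ (P.qhat τ x) - P.loss θ (P.qhat τ m) :=
    ((continuous_loss hb hh θ).comp (by unfold qhat; fun_prop)).sub continuous_const
  have hD : MemLp (fun x => P.loss θ (P.qhat τ x) - P.loss θ (P.qhat τ m)) 2 (gaussianReal m v) := by
    refine (hx.const_mul (P.b + P.h)).mono hc.aestronglyMeasurable (Eventually.of_forall fun x => ?_)
    rw [norm_mul, Real.norm_eq_abs, Real.norm_eq_abs, Real.norm_eq_abs,
      abs_of_nonneg (add_nonneg hb hh)]
    exact hbd x
  constructor
  · refine (hD.add (memLp_const (P.loss θ (P.qhat τ m)))).congr_norm ?_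
      (Eventually.of_forall fun x => by simp)
    exact ((continuous_loss hb hh θ).comp (by unfold qhat; fun_prop)).aestronglyMeasurable
  · have hv : ∫ x, (x - m) ^ 2 ∂(gaussianReal m v) = v := by
      have := variance_eq_integral (μ := gaussianReal m v) (X := fun x => x) (by fun_prop)
      rw [variance_fun_id_gaussianReal, integral_id_gaussianReal] at this
      exact this.symm
    calc _ ≤ ∫ x, (P.b + P.h) ^ 2 * (x - m) ^ 2 ∂(gaussianReal m v) := by
          refine integral_mono hD.integrable_sq (hx.integrable_sq.const_mul _) fun x => ?_
          have := pow_le_pow_left₀ (abs_nonneg _) (hbd x) 2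
          rwa [mul_pow, sq_abs, sq_abs] at this
      _ = _ := by rw [integral_const_mul, hv]

/-- The risk of the coordinate predictor in closed form. -/
lemma integral_loss_qhat (hb : 0 ≤ P.b) (hh : 0 ≤ P.h) (hbh : 0 < P.b + P.h)
    (hσf : 0 < (P.σf : ℝ)) (τ : ℝ≥0∞) (θ : ℝ) :
    ∫ x, P.loss θ (P.qhat τ x) ∂(gaussianReal θ P.σp)
      = (P.b + P.h) * √(P.σf + P.σp * P.alpha τ ^ 2) * G (P.c τ + P.d τ * θ) P.ratio := by
  set a := P.alpha τ
  set k := √(P.σf + a * P.σp) * stdQuantile P.ratio with hk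
  set s := √(P.σf + P.σp * a ^ 2) with hs
  have hA : 0 < (P.σf : ℝ) + P.σp * a ^ 2 := by positivity
  have hs0 : 0 < s := Real.sqrt_pos.2 hA
  -- The prediction error `Y - q̂` is Gaussian of variance `σf + a² σp`; its law is the convolution
  -- of the law of `-q̂` with that of `Y`.
  have h1 : (gaussianReal θ P.σp).map (fun x => -(a * x + k))
      = gaussianReal (-(a * θ + k)) (P.σp * (a ^ 2).toNNReal) := by
    have e : (fun x : ℝ => -(a * x + k)) = (fun x => -k + x) ∘ fun x => -a * x := by
      ext x; simp
    rw [e, ← Measure.map_map (by fun_prop) (by fun_prop), gaussianReal_map_const_mul,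
      gaussianReal_map_const_add]
    congr 1
    · ring
    · ext; simp [mul_comm, sq_nonneg]
  have h2 : gaussianReal (-(a * θ + k)) (P.σp * (a ^ 2).toNNReal) ∗ gaussianReal θ P.σf
      = gaussianReal (-(a * θ + k) + θ) (s ^ 2).toNNReal := by
    rw [gaussianReal_conv_gaussianReal]
    congr 1
    ext
    rw [Real.coe_toNNReal _ (sq_nonneg _), hs, Real.sq_sqrt hA.le]
    push_cast
    rw [Real.coe_toNNReal _ (sq_nonneg _)]; ring
  have h3 := integral_conv (μ := gaussianReal (-(a * θ + k)) (P.σp * (a ^ 2).toNNReal))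
    (ν := gaussianReal θ P.σf) (f := checkFun P.b P.h) (by
      rw [h2]; exact integrable_checkFun _ _ _ _)
  have hcont : Continuous fun w => ∫ y, checkFun P.b P.h (w + y) ∂(gaussianReal θ P.σf) := by
    have : (fun w => ∫ y, checkFun P.b P.h (w + y) ∂(gaussianReal θ P.σf))
        = fun w => P.loss θ (-w) := by
      ext w; rw [loss_eq, neg_neg]; simp only [add_comm]
    rw [this]; exact (continuous_loss hb hh θ).comp continuous_neg
  rw [h2, integral_checkFun hbh _ hs0, ← h1, integral_map (by fun_prop)
    hcont.aestronglyMeasurable] at h3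
  have e : P.c τ + P.d τ * θ = -(-(a * θ + k) + θ) / s := by
    have hs' : √(P.σf + a ^ 2 * P.σp : ℝ) = s := by rw [hs, mul_comm (a ^ 2)]
    have ha : P.alpha τ = a := rfl
    have ha0 : 0 ≤ a := P.alpha_nonneg τ
    rw [c, d, ha, Real.sqrt_div (by positivity), hs', hk]
    field_simp
    ring
  rw [e, ratio, h3]
  congr 1; ext x
  rw [loss_eq]
  simp only [qhat, add_comm]
  rfl

/-- The error of the risk estimate of one coordinate as an estimate of its loss. -/
def gap (P : Coord) (γ : ℝ) (n : ℕ) (τ : ℝ≥0∞) (θ x : ℝ) : ℝ :=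
  (P.b + P.h) * √(P.σf + P.σp * P.alpha τ ^ 2) * P.T γ n τ x - P.loss θ (P.qhat τ x)

lemma variance_le_integral_sub_sq {Ω : Type*} {mΩ : MeasurableSpace Ω} {μ : Measure Ω}
    [IsProbabilityMeasure μ] {f : Ω → ℝ} (hf : AEStronglyMeasurable f μ) (k : ℝ) :
    Var[f; μ] ≤ ∫ x, (f x - k) ^ 2 ∂μ := by
  rw [← variance_sub_const hf k]
  exact variance_le_expectation_sq (hf.sub aestronglyMeasurable_const)

/-- The loss has mean exactly `C * g`, so the mean of the gap is `C` times the bias of `T`. Its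
variance is bounded by the mean square about a convenient constant, which separates the squared
error of `T` from the fluctuation of the loss. -/
theorem Admissible.gap_bounds {γ₀ γ : ℝ} (h : P.Admissible γ₀ γ) {n : ℕ} (hn : 3 ≤ n) {τ : ℝ≥0∞}
    (hτ : τ ≠ ∞) (θ : ℝ) {A B : ℝ} (hA : P.b + P.h ≤ A) (hB : (P.σf : ℝ) + P.σp ≤ B) :
    MemLp (P.gap γ n τ θ) 2 (gaussianReal θ P.σp) ∧
    |∫ x, P.gap γ n τ θ x ∂(gaussianReal θ P.σp)| ≤ A * √B * biasBound γ₀ n ∧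
    Var[P.gap γ n τ θ; gaussianReal θ P.σp] ≤ 2 * (A ^ 2 * B) * (mseBound γ₀ n + 1) := by
  have hb := h.b_pos.le
  have hh := h.h_pos.le
  have hbh : 0 < P.b + P.h := add_pos h.b_pos h.h_pos
  have hσf := h.σf_pos
  have hσp := h.σp_pos
  have hA0 : 0 ≤ A := by linarith
  have hB0 : 0 ≤ B := by linarith
  set g := G (P.c τ + P.d τ * θ) P.ratio
  set κ := gaussianReal θ P.σp
  set C := (P.b + P.h) * √(P.σf + P.σp * P.alpha τ ^ 2) with hC
  obtain ⟨hT, hbias, hmse⟩ := h.T_bounds hn hτ θ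
  obtain ⟨hL, hLv⟩ := memLp_loss_qhat hb hh τ θ θ P.σp
  have hC0 : 0 ≤ C := by positivity
  have hs : (P.σf : ℝ) + P.σp * P.alpha τ ^ 2 ≤ B := by
    have : P.alpha τ ^ 2 ≤ 1 := pow_le_one₀ (P.alpha_nonneg τ) (P.alpha_le_one τ)
    have : (P.σp : ℝ) * P.alpha τ ^ 2 ≤ P.σp := mul_le_of_le_one_right hσp.le this
    linarith
  have hCA : C ≤ A * √B := by rw [hC]; gcongr
  have hC2 : C ^ 2 ≤ A ^ 2 * B := by
    calc C ^ 2 ≤ (A * √B) ^ 2 := by gcongr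
      _ = _ := by rw [mul_pow, Real.sq_sqrt hB0]
  have hgap : MemLp (P.gap γ n τ θ) 2 κ := (hT.const_mul C).sub hL
  refine ⟨hgap, ?_, ?_⟩
  · have e : ∫ x, P.gap γ n τ θ x ∂κ = C * (∫ x, P.T γ n τ x ∂κ - g) := by
      simp only [gap]
      rw [integral_sub ((hT.integrable (by norm_num)).const_mul C) (hL.integrable (by norm_num)),
        integral_loss_qhat hb hh hbh hσf, integral_const_mul]
      ring
    rw [e, abs_mul, abs_of_nonneg hC0]
    gcongr
  · refine (variance_le_integral_sub_sq hgap.aestronglyMeasurable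
      (C * g - P.loss θ (P.qhat τ θ))).trans ?_
    have hi1 : Integrable (fun x => (P.T γ n τ x - g) ^ 2) κ := (hT.sub (memLp_const g)).integrable_sq
    have hi2 : Integrable (fun x => (P.loss θ (P.qhat τ x) - P.loss θ (P.qhat τ θ)) ^ 2) κ :=
      (hL.sub (memLp_const _)).integrable_sq
    calc _ ≤ ∫ x, (2 * C ^ 2 * (P.T γ n τ x - g) ^ 2
          + 2 * (P.loss θ (P.qhat τ x) - P.loss θ (P.qhat τ θ)) ^ 2) ∂κ := by
          refine integral_mono (hgap.sub (memLp_const _)).integrable_sq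
            ((hi1.const_mul _).add (hi2.const_mul 2)) fun x => ?_
          simp only [gap]
          nlinarith [sq_nonneg (C * (P.T γ n τ x - g)
            + (P.loss θ (P.qhat τ x) - P.loss θ (P.qhat τ θ)))]
      _ = 2 * C ^ 2 * ∫ x, (P.T γ n τ x - g) ^ 2 ∂κ
          + 2 * ∫ x, (P.loss θ (P.qhat τ x) - P.loss θ (P.qhat τ θ)) ^ 2 ∂κ := by
          rw [integral_add (hi1.const_mul _) (hi2.const_mul 2), integral_const_mul,
            integral_const_mul]
      _ ≤ 2 * (A ^ 2 * B) * mseBound γ₀ n + 2 * (A ^ 2 * B) := by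
          refine add_le_add (mul_le_mul (by linarith) hmse
            (integral_nonneg fun x => sq_nonneg _) (by positivity)) ?_
          refine mul_le_mul_of_nonneg_left (hLv.trans ?_) (by norm_num)
          gcongr
          linarith
      _ = _ := by ring

end Coord

/-! ### Averages over the coordinates -/

instance (P : ℕ → Coord) (θ : ℕ → ℝ) (n : ℕ) : IsProbabilityMeasure (dataLaw P θ n) := by
  unfold dataLaw; infer_instance

lemma memLp_eval_dataLaw (P : ℕ → Coord) (θ : ℕ → ℝ) {n : ℕ} (i : Fin n) {p : ℝ≥0∞} {f : ℝ → ℝ}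
    (hf : MemLp f p (gaussianReal (θ i) (P i).σp)) :
    MemLp (fun x : Fin n → ℝ => f (x i)) p (dataLaw P θ n) :=
  hf.comp_measurePreserving
    (measurePreserving_eval (fun i : Fin n => gaussianReal (θ i) (P i).σp) i)

lemma integral_eval_dataLaw (P : ℕ → Coord) (θ : ℕ → ℝ) {n : ℕ} (i : Fin n) {f : ℝ → ℝ}
    (hf : AEStronglyMeasurable f (gaussianReal (θ i) (P i).σp)) :
    ∫ x, f (x i) ∂(dataLaw P θ n) = ∫ x, f x ∂(gaussianReal (θ i) (P i).σp) :=
  integral_comp_eval (μ := fun i : Fin n => gaussianReal (θ i) (P i).σp) hf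

/-- Mean and variance of an average of independent coordinates. -/
lemma average_bounds (P : ℕ → Coord) (θ : ℕ → ℝ) {n : ℕ} (hn : 0 < n) {f : Fin n → ℝ → ℝ} {m V : ℝ}
    (hf : ∀ i : Fin n, MemLp (f i) 2 (gaussianReal (θ i) (P i).σp))
    (hm : ∀ i : Fin n, |∫ x, f i x ∂(gaussianReal (θ i) (P i).σp)| ≤ m)
    (hV : ∀ i : Fin n, Var[f i; gaussianReal (θ i) (P i).σp] ≤ V) :
    MemLp (fun x => (1 / n : ℝ) * ∑ i, f i (x i)) 2 (dataLaw P θ n) ∧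
    |∫ x, (1 / n : ℝ) * ∑ i, f i (x i) ∂(dataLaw P θ n)| ≤ m ∧
    Var[fun x => (1 / n : ℝ) * ∑ i, f i (x i); dataLaw P θ n] ≤ V / n := by
  have hn0 : (0 : ℝ) < n := by exact_mod_cast hn
  have hL : ∀ i : Fin n, MemLp (fun x : Fin n → ℝ => f i (x i)) 2 (dataLaw P θ n) :=
    fun i => memLp_eval_dataLaw P θ i (hf i)
  refine ⟨(memLp_finsetSum _ fun i _ => hL i).const_mul _, ?_, ?_⟩
  · rw [integral_const_mul, integral_finsetSum _ fun i _ => (hL i).integrable (by norm_num), abs_mul,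
      abs_of_pos (by positivity : (0 : ℝ) < 1 / n)]
    have : |∑ i, ∫ x, f i (x i) ∂(dataLaw P θ n)| ≤ ∑ _i : Fin n, m := by
      refine (Finset.abs_sum_le_sum_abs _ _).trans (Finset.sum_le_sum fun i _ => ?_)
      rw [integral_eval_dataLaw P θ i (hf i).aestronglyMeasurable]
      exact hm i
    calc _ ≤ 1 / (n : ℝ) * ∑ _i : Fin n, m := by gcongr
      _ = m := by simp; field_simp
  · have h1 : Var[∑ i, fun x : Fin n → ℝ => f i (x i); dataLaw P θ n]
        = ∑ i : Fin n, Var[f i; gaussianReal (θ i) (P i).σp] :=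
      variance_sum_pi (μ := fun i : Fin n => gaussianReal (θ i) (P i).σp) hf
    have e : (fun x : Fin n → ℝ => ∑ i, f i (x i)) = ∑ i, fun x : Fin n → ℝ => f i (x i) := by
      ext x; simp
    rw [variance_const_mul, e, h1]
    calc (1 / n : ℝ) ^ 2 * ∑ i : Fin n, Var[f i; gaussianReal (θ i) (P i).σp]
        ≤ (1 / n : ℝ) ^ 2 * ∑ _i : Fin n, V := by gcongr with i; exact hV i
      _ = V / n := by simp; field_simp

lemma ARE_sub_avgLoss (P : ℕ → Coord) (γ θ : ℕ → ℝ) (n : ℕ) (τ : ℝ≥0∞) (x : Fin n → ℝ) :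
    ARE P γ n τ x - avgLoss P θ n τ x
      = (1 / n : ℝ) * ∑ i : Fin n, (P i).gap (γ i) n τ (θ i) (x i) := by
  rw [ARE, avgLoss, ← mul_sub, ← Finset.sum_sub_distrib]; rfl

/-- The risk estimate is uniformly close to the loss on finitely many hyperparameters. -/
theorem exists_uniform_error {P : ℕ → Coord} {γ : ℕ → ℝ} {γ₀ A B : ℝ}
    (hP : ∀ i, (P i).Admissible γ₀ (γ i)) (hA : ∀ i, (P i).b + (P i).h ≤ A)
    (hB : ∀ i, ((P i).σf : ℝ) + (P i).σp ≤ B) (θ : ℕ → ℝ) {n : ℕ} (hn : 3 ≤ n) (N : ℕ)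
    {τ : ℕ → ℝ≥0∞} (hτ : ∀ j < N, τ j ≠ ∞) {s : ℝ} (hs : 0 < s) :
    ∃ E : (Fin n → ℝ) → ℝ, Integrable E (dataLaw P θ n) ∧
      (∀ x, ∀ j < N, |ARE P γ n (τ j) x - avgLoss P θ n (τ j) x| ≤ E x) ∧
      ∫ x, E x ∂(dataLaw P θ n)
        ≤ A * √B * biasBound γ₀ n + s + N * (2 * (A ^ 2 * B) * (mseBound γ₀ n + 1) / n) / s := by
  set ν := dataLaw P θ n
  set D : ℕ → (Fin n → ℝ) → ℝ := fun j x => ARE P γ n (τ j) x - avgLoss P θ n (τ j) x with hD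
  have hbd : ∀ j < N, MemLp (D j) 2 ν ∧ |∫ x, D j x ∂ν| ≤ A * √B * biasBound γ₀ n ∧
      Var[D j; ν] ≤ 2 * (A ^ 2 * B) * (mseBound γ₀ n + 1) / n := fun j hj => by
    have hg := fun i : Fin n => (hP i).gap_bounds hn (hτ j hj) (θ i) (hA i) (hB i)
    have := average_bounds P θ (by omega : 0 < n) (fun i => (hg i).1) (fun i => (hg i).2.1)
      fun i => (hg i).2.2
    simpa only [hD, ARE_sub_avgLoss] using this
  set m : ℕ → ℝ := fun j => ∫ x, D j x ∂ν
  have hsq : ∀ j ∈ Finset.range N, Integrable (fun x => (D j x - m j) ^ 2) ν := fun j hj =>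
    ((hbd j (Finset.mem_range.1 hj)).1.sub (memLp_const _)).integrable_sq
  have hsum : Integrable (fun x => (∑ j ∈ Finset.range N, (D j x - m j) ^ 2) / s) ν :=
    (integrable_finsetSum _ hsq).div_const s
  -- `|y| ≤ s + y²/s` makes a single function dominate the errors at all `N` points; its mean
  -- involves only the sum of the variances.
  refine ⟨fun x => A * √B * biasBound γ₀ n + s + (∑ j ∈ Finset.range N, (D j x - m j) ^ 2) / s,
    (integrable_const _).add hsum, fun x j hj => ?_, ?_⟩
  · have h1 : (D j x - m j) ^ 2 ≤ ∑ j ∈ Finset.range N, (D j x - m j) ^ 2 :=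
      Finset.single_le_sum (f := fun j => (D j x - m j) ^ 2) (fun _ _ => sq_nonneg _)
        (Finset.mem_range.2 hj)
    have h2 : |D j x - m j| ≤ s + (D j x - m j) ^ 2 / s := by
      rw [← sub_le_iff_le_add', le_div_iff₀ hs, ← sq_abs (D j x - m j)]
      nlinarith [sq_nonneg (|D j x - m j| - s), abs_nonneg (D j x - m j)]
    have h3 : (D j x - m j) ^ 2 / s ≤ (∑ j ∈ Finset.range N, (D j x - m j) ^ 2) / s := by gcongr
    have h4 : |D j x| ≤ |m j| + |D j x - m j| := by
      have := abs_add_le (m j) (D j x - m j)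
      rwa [add_sub_cancel] at this
    linarith [(hbd j hj).2.1]
  · rw [integral_add (integrable_const _) hsum, integral_const, probReal_univ, one_smul, integral_div,
      integral_finsetSum _ hsq]
    have : ∑ j ∈ Finset.range N, ∫ x, (D j x - m j) ^ 2 ∂ν
        ≤ ∑ _j ∈ Finset.range N, 2 * (A ^ 2 * B) * (mseBound γ₀ n + 1) / n := by
      refine Finset.sum_le_sum fun j hj => ?_
      obtain ⟨h1, -, h3⟩ := hbd j (Finset.mem_range.1 hj)
      rwa [variance_eq_integral h1.aemeasurable] at h3
    rw [Finset.sum_const, Finset.card_range, nsmul_eq_mul] at this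
    gcongr

/-! ### Discretization of the hyperparameter -/

/-- The grid point `τ` with `τ / (τ + 1) = t`. -/
def gridPoint (t : ℝ) : ℝ≥0∞ := ENNReal.ofReal t / ENNReal.ofReal (1 - t)

lemma gridPoint_ne_top {t : ℝ} (ht : t < 1) : gridPoint t ≠ ∞ :=
  ENNReal.div_ne_top ENNReal.ofReal_ne_top (by simpa using ht)

namespace Coord

variable (P : Coord)

/-- The shrinkage factor as a function of `t = τ / (τ + 1)`. -/
def alphaUnit (t : ℝ) : ℝ := t / (t + P.σp * (1 - t))

lemma alpha_gridPoint {t : ℝ} (ht0 : 0 ≤ t) (ht1 : t < 1) :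
    P.alpha (gridPoint t) = P.alphaUnit t := by
  have h1 : 0 < 1 - t := by linarith
  rw [alpha, if_neg (gridPoint_ne_top ht1), gridPoint, ENNReal.toReal_div,
    ENNReal.toReal_ofReal ht0, ENNReal.toReal_ofReal h1.le, alphaUnit]
  have : t / (1 - t) + P.σp = (t + P.σp * (1 - t)) / (1 - t) := by field_simp
  rw [this, div_div_div_cancel_right₀ h1.ne']

/-- The choice `t = τ / (τ + 1)`, with `t = 1` at `∞`, works for all coordinates simultaneously. -/
lemma exists_alpha_eq (τ : ℝ≥0∞) : ∃ t, 0 ≤ t ∧ t ≤ 1 ∧ ∀ P : Coord, P.alpha τ = P.alphaUnit t := by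
  by_cases hτ : τ = ∞
  · exact ⟨1, zero_le_one, le_rfl, fun P => by simp [alpha, alphaUnit, hτ]⟩
  · have h0 : 0 ≤ τ.toReal := ENNReal.toReal_nonneg
    refine ⟨τ.toReal / (τ.toReal + 1), by positivity, div_le_one_of_le₀ (by linarith) (by linarith),
      fun P => ?_⟩
    rw [alpha, if_neg hτ, alphaUnit]
    have : τ.toReal / (τ.toReal + 1) + P.σp * (1 - τ.toReal / (τ.toReal + 1))
        = (τ.toReal + P.σp) / (τ.toReal + 1) := by field_simp; ring
    rw [this, div_div_div_cancel_right₀ (by linarith)]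

/-- The difference is `σp (t - u)` over the product of the denominators, each a convex combination
of `1` and `σp`, hence at least `1/K`. -/
lemma abs_alphaUnit_sub_le {K : ℝ} (hσ : 0 < (P.σp : ℝ)) (hK : (P.σp : ℝ) ≤ K)
    (hK' : (P.σp : ℝ)⁻¹ ≤ K) {t u : ℝ} (ht0 : 0 ≤ t) (ht1 : t ≤ 1) (hu0 : 0 ≤ u) (hu1 : u ≤ 1) :
    |P.alphaUnit t - P.alphaUnit u| ≤ K ^ 3 * |t - u| := by
  have hK0 : 0 < K := by linarith
  have hKσ : 1 ≤ K * P.σp := by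
    have := mul_le_mul_of_nonneg_right hK' hσ.le
    rwa [inv_mul_cancel₀ hσ.ne'] at this
  have hK1 : 1 ≤ K := by nlinarith
  have hden : ∀ t : ℝ, 0 ≤ t → t ≤ 1 → 1 / K ≤ t + P.σp * (1 - t) := fun t h0 h1 => by
    rw [div_le_iff₀ hK0]
    nlinarith [mul_nonneg h0 (by linarith : 0 ≤ K - 1),
      mul_nonneg (by linarith : 0 ≤ 1 - t) (by linarith : 0 ≤ K * P.σp - 1)]
  have hK' : 0 < 1 / K := by positivity
  have ht := hden t ht0 ht1
  have hu := hden u hu0 hu1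
  have e : P.alphaUnit t - P.alphaUnit u
      = P.σp / ((t + P.σp * (1 - t)) * (u + P.σp * (1 - u))) * (t - u) := by
    have h1 : t + P.σp * (1 - t) ≠ 0 := by linarith
    have h2 : u + P.σp * (1 - u) ≠ 0 := by linarith
    rw [alphaUnit, alphaUnit, div_sub_div _ _ h1 h2, div_mul_eq_mul_div]
    congr 1; ring
  rw [e, abs_mul]
  gcongr
  rw [abs_of_nonneg (by
    have : 0 ≤ (t + P.σp * (1 - t)) * (u + P.σp * (1 - u)) := mul_nonneg (by linarith) (by linarith)
    positivity)]
  calc (P.σp : ℝ) / ((t + P.σp * (1 - t)) * (u + P.σp * (1 - u))) ≤ K / (1 / K * (1 / K)) := by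
        gcongr
    _ = K ^ 3 := by field_simp

lemma abs_qhat_sub_le (hσf : 0 < (P.σf : ℝ)) (τ τ' : ℝ≥0∞) (x : ℝ) :
    |P.qhat τ x - P.qhat τ' x|
      ≤ |P.alpha τ - P.alpha τ'| * (|x| + P.σp / √P.σf * |stdQuantile P.ratio|) := by
  have hs : |√(P.σf + P.alpha τ * P.σp) - √(P.σf + P.alpha τ' * P.σp)|
      ≤ |P.alpha τ - P.alpha τ'| * (P.σp / √P.σf) := by
    have ha := P.alpha_nonneg τ
    have ha' := P.alpha_nonneg τ'
    have h0 : 0 < √(P.σf : ℝ) := Real.sqrt_pos.2 hσf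
    set y := √(P.σf + P.alpha τ * P.σp)
    set y' := √(P.σf + P.alpha τ' * P.σp)
    have hy : √(P.σf : ℝ) ≤ y := Real.sqrt_le_sqrt (le_add_of_nonneg_right (by positivity))
    have hy' : 0 ≤ y' := Real.sqrt_nonneg _
    have h1 : (y - y') * (y + y') = (P.alpha τ - P.alpha τ') * P.σp := by
      have e1 : y ^ 2 = P.σf + P.alpha τ * P.σp := Real.sq_sqrt (by positivity)
      have e2 : y' ^ 2 = P.σf + P.alpha τ' * P.σp := Real.sq_sqrt (by positivity)
      linear_combination e1 - e2
    have h2 : |y - y'| * (y + y') = |P.alpha τ - P.alpha τ'| * P.σp := by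
      rw [← abs_of_nonneg (by linarith : 0 ≤ y + y'), ← abs_mul, h1, abs_mul,
        NNReal.abs_eq]
    rw [mul_div_assoc', le_div_iff₀ h0, ← h2]
    gcongr
    linarith
  rw [qhat, qhat, show P.alpha τ * x + √(P.σf + P.alpha τ * P.σp) * stdQuantile P.ratio
      - (P.alpha τ' * x + √(P.σf + P.alpha τ' * P.σp) * stdQuantile P.ratio)
      = (P.alpha τ - P.alpha τ') * x + (√(P.σf + P.alpha τ * P.σp)
        - √(P.σf + P.alpha τ' * P.σp)) * stdQuantile P.ratio by ring]
  refine (abs_add_le _ _).trans ?_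
  rw [abs_mul, abs_mul, mul_add, ← mul_assoc]
  gcongr

end Coord

lemma exists_nat_mul_close {t δ : ℝ} (ht0 : 0 ≤ t) (ht1 : t ≤ 1) (hδ : 0 < δ) :
    ∃ j < ⌈1 / δ⌉₊, |t - j * δ| ≤ δ := by
  have hpos : 0 < ⌈1 / δ⌉₊ := Nat.ceil_pos.2 (by positivity)
  -- Rounding down by `⌊t / δ⌋` could leave the grid at `t = 1` when `1/δ` is an integer. At `t = 0`
  -- the natural subtraction returns `0`.
  refine ⟨⌈t / δ⌉₊ - 1, ?_, ?_⟩
  · have : ⌈t / δ⌉₊ ≤ ⌈1 / δ⌉₊ := Nat.ceil_mono (by gcongr)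
    omega
  · rcases ht0.eq_or_lt with rfl | h
    · simp [hδ.le]
    · have h1 : 1 ≤ ⌈t / δ⌉₊ := Nat.ceil_pos.2 (by positivity)
      have h2 := Nat.le_ceil (t / δ)
      have h3 := Nat.ceil_lt_add_one (a := t / δ) (by positivity)
      rw [Nat.cast_sub h1, Nat.cast_one]
      rw [div_le_iff₀ hδ] at h2
      have h4 : (⌈t / δ⌉₊ : ℝ) * δ < (t / δ + 1) * δ := by gcongr
      rw [add_mul, div_mul_cancel₀ _ hδ.ne'] at h4
      rw [abs_le]
      constructor <;> linarith

lemma abs_avgLoss_sub_le {P : ℕ → Coord} (hb : ∀ i, 0 ≤ (P i).b) (hh : ∀ i, 0 ≤ (P i).h) {A H κ : ℝ}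
    (hA : ∀ i, (P i).b + (P i).h ≤ A) (hσf : ∀ i, 0 < ((P i).σf : ℝ))
    (hH : ∀ i, (P i).σp / √(P i).σf * |stdQuantile (P i).ratio| ≤ H) {τ τ' : ℝ≥0∞}
    (hκ : ∀ i, |(P i).alpha τ - (P i).alpha τ'| ≤ κ) (θ : ℕ → ℝ) {n : ℕ} (hn : 0 < n)
    (x : Fin n → ℝ) :
    |avgLoss P θ n τ x - avgLoss P θ n τ' x| ≤ A * κ * ((1 / n) * ∑ i, |x i| + H) := by
  have hn0 : (0 : ℝ) < n := by exact_mod_cast hn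
  have hA0 : 0 ≤ A := (add_nonneg (hb 0) (hh 0)).trans (hA 0)
  rw [avgLoss, avgLoss, ← mul_sub, ← Finset.sum_sub_distrib, abs_mul,
    abs_of_pos (by positivity : (0 : ℝ) < 1 / n)]
  have : |∑ i : Fin n, ((P i).loss (θ i) ((P i).qhat τ (x i)) - (P i).loss (θ i) ((P i).qhat τ' (x i)))|
      ≤ ∑ i : Fin n, A * κ * (|x i| + H) := by
    refine (Finset.abs_sum_le_sum_abs _ _).trans (Finset.sum_le_sum fun i _ => ?_)
    refine (Coord.abs_loss_sub_le (hb i) (hh i) _ _ _).trans ?_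
    rw [mul_assoc]
    refine mul_le_mul (hA i) (((P i).abs_qhat_sub_le (hσf i) τ τ' (x i)).trans ?_)
      (abs_nonneg _) hA0
    have := (abs_nonneg _).trans (hκ i)
    gcongr
    · exact hκ i
    · exact hH i
  calc _ ≤ 1 / (n : ℝ) * ∑ i : Fin n, A * κ * (|x i| + H) := by gcongr
    _ = _ := by
      rw [← Finset.mul_sum, Finset.sum_add_distrib]
      simp
      field_simp

/-! ### Asymptotics -/

lemma tendsto_log_natCast : Tendsto (fun n : ℕ => Real.log n) atTop atTop :=
  Real.tendsto_log_atTop.comp tendsto_natCast_atTop_atTop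

lemma tendsto_sqrt_two_log : Tendsto (fun n : ℕ => √(2 * Real.log n)) atTop atTop :=
  Real.tendsto_sqrt_atTop.comp (tendsto_log_natCast.const_mul_atTop (by norm_num))

lemma tendsto_log_pow_div_sqrt (k : ℕ) :
    Tendsto (fun n : ℕ => Real.log n ^ k / √n) atTop (𝓝 0) := by
  have h := (isLittleO_log_rpow_rpow_atTop (s := 1 / 2) (k : ℝ) (by norm_num)).tendsto_div_nhds_zero
  have := h.comp tendsto_natCast_atTop_atTop
  refine this.congr fun n => ?_
  simp [Real.sqrt_eq_rpow]

lemma tendsto_biasBound {γ₀ : ℝ} (hγ₀ : 0 < γ₀) : Tendsto (biasBound γ₀) atTop (𝓝 0) := by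
  have h1 : Tendsto (fun n : ℕ => 81 / (γ₀ * √(2 * Real.log n))) atTop (𝓝 0) :=
    tendsto_const_nhds.div_atTop (tendsto_sqrt_two_log.const_mul_atTop hγ₀)
  have h3 : Tendsto (fun n : ℕ => 3 / √(2 * Real.log n)) atTop (𝓝 0) :=
    tendsto_const_nhds.div_atTop tendsto_sqrt_two_log
  have h4 : Tendsto (fun n : ℕ => 1 / (n : ℝ)) atTop (𝓝 0) :=
    tendsto_const_nhds.div_atTop tendsto_natCast_atTop_atTop
  have h2 : Tendsto (fun n : ℕ => 6 * (3 * Real.log n + 2) ^ 2 * √n / n) atTop (𝓝 0) := by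
    have := (((tendsto_log_pow_div_sqrt 2).const_mul 54).add
      ((tendsto_log_pow_div_sqrt 1).const_mul 72)).add ((tendsto_log_pow_div_sqrt 0).const_mul 24)
    norm_num at this
    refine this.congr' ?_
    filter_upwards [eventually_gt_atTop 0] with n hn
    have hn0 : (0 : ℝ) < n := by exact_mod_cast hn
    have hs := Real.sqrt_pos.2 hn0
    have hinv : √n / (n : ℝ) = (√n)⁻¹ := by
      rw [div_eq_iff hn0.ne', inv_mul_eq_div, Real.div_sqrt]
    rw [mul_div_assoc, hinv]
    field_simp
    ring
  have := ((h1.add h2).add h3).add h4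
  rw [add_zero, add_zero, add_zero] at this
  exact this

/-- The dominant term is `9 n / √(2 log n)`, from large means. The constant is `328 = 300 + 12 + 9 +
7`, collected from the other terms below. -/
lemma eventually_mseBound_le {γ₀ : ℝ} (hγ₀ : 0 < γ₀) :
    ∀ᶠ n : ℕ in atTop, (mseBound γ₀ n + 1) / n ≤ (80 / γ₀ + 328) / √(Real.log n) := by
  filter_upwards [tendsto_log_natCast.eventually_ge_atTop 1, eventually_gt_atTop 0,
    (tendsto_log_pow_div_sqrt 3).eventually_le_const one_pos] with n hl hn h3
  have hn1 : (1 : ℝ) ≤ n := by exact_mod_cast hn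
  have hn0 : (0 : ℝ) < n := by linarith
  set l := Real.log n
  set q := √(n : ℝ) with hq
  have hq1 : 1 ≤ q := Real.one_le_sqrt.2 hn1
  have hqq : q * q = n := Real.mul_self_sqrt hn0.le
  have hqn : q ≤ n := by rw [← hqq]; exact le_mul_of_one_le_left (by linarith) hq1
  set r := √l with hr
  have hr1 : 1 ≤ r := Real.one_le_sqrt.2 hl
  have hr0 : 0 < r := by linarith
  have hrr : r * r = l := Real.mul_self_sqrt (by linarith)
  have hrl : r ≤ l := by rw [← hrr]; exact le_mul_of_one_le_left (by linarith) hr1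
  rw [div_le_one (by linarith)] at h3
  have hll : l ≤ l ^ 2 := le_self_pow₀ hl (by norm_num)
  have hl23 : l ^ 2 ≤ l ^ 3 := pow_le_pow_right₀ hl (by norm_num)
  set t := √(2 * l) with ht
  have htt : t ^ 2 = 2 * l := Real.sq_sqrt (by linarith)
  have hrt : r ≤ t := Real.sqrt_le_sqrt (by linarith)
  have ht1 : 1 ≤ t := hr1.trans hrt
  rw [div_le_div_iff₀ hn0 hr0]
  have hrn : r ≤ n := by linarith
  have b1 : 80 / (γ₀ * t) * r ≤ 80 / γ₀ * n := by
    have : γ₀ ≤ γ₀ * t := le_mul_of_one_le_right hγ₀.le ht1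
    gcongr
  have b2 : 12 * (3 * l + 2) ^ 2 * q * r ≤ 300 * n := by
    have h5 : (3 * l + 2) ^ 2 ≤ (5 * l) ^ 2 := by gcongr; linarith
    calc 12 * (3 * l + 2) ^ 2 * q * r ≤ 12 * (5 * l) ^ 2 * q * l := by gcongr
      _ = 300 * (l ^ 3 * q) := by ring
      _ ≤ 300 * (q * q) := by gcongr
      _ = 300 * n := by rw [hqq]
  have b3 : 2 * (1 + t) ^ 2 * r ≤ 12 * n := by
    have : 2 * (1 + t) ^ 2 ≤ 12 * l := by nlinarith [sq_nonneg (t - 1)]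
    calc 2 * (1 + t) ^ 2 * r ≤ 12 * l * l := by gcongr
      _ = 12 * l ^ 2 := by ring
      _ ≤ 12 * n := by linarith
  have b4 : 9 * n / t * r ≤ 9 * n := by
    rw [div_mul_eq_mul_div, div_le_iff₀ (by linarith)]
    gcongr
  have e : (mseBound γ₀ n + 1) * r = 80 / (γ₀ * t) * r + 12 * (3 * l + 2) ^ 2 * q * r
      + 2 * (1 + t) ^ 2 * r + 9 * n / t * r + 7 * r := by
    rw [mseBound]; ring
  rw [e]
  linarith

lemma tendsto_loglog : Tendsto (fun n : ℕ => Real.log (Real.log n)) atTop atTop :=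
  Real.tendsto_log_atTop.comp tendsto_log_natCast

lemma tendsto_gridStep {C₁ C₂ C₃ C₄ : ℝ} (h₁ : 0 < C₁) (h₂ : 0 < C₂) (h₃ : 0 ≤ C₃)
    (h₄ : 0 < C₄) :
    Tendsto (gridStep C₁ C₂ C₃ C₄) atTop (𝓝 0) := by
  refine tendsto_inv_atTop_zero.comp (Tendsto.const_mul_atTop (by positivity) ?_)
  refine tendsto_atTop_mono' _ ?_ tendsto_loglog
  filter_upwards with n
  have := stdPdf_pos 0
  have : 0 ≤ √(Real.log (Real.log n)) * C₄ := by positivity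
  linarith

lemma eventually_gridStep {C₁ C₂ C₃ C₄ : ℝ} (h₁ : 0 < C₁) (h₂ : 0 < C₂) (h₃ : 0 ≤ C₃)
    (h₄ : 0 < C₄) :
    ∀ᶠ n : ℕ in atTop, 0 < gridStep C₁ C₂ C₃ C₄ n ∧ (⌈1 / gridStep C₁ C₂ C₃ C₄ n⌉₊ : ℝ)
      ≤ (2 * C₁ * C₂ * (2 * stdPdf 0 + C₃ + C₄ + 1) + 1) * Real.log (Real.log n) := by
  filter_upwards [tendsto_loglog.eventually_ge_atTop 1] with n hn
  set L := Real.log (Real.log n) with hL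
  have hφ := stdPdf_pos 0
  have hsq : √L ≤ L := Real.sqrt_le_iff.2 ⟨by linarith, by nlinarith⟩
  have hpos : 0 < gridStep C₁ C₂ C₃ C₄ n := by
    unfold gridStep
    have : 0 ≤ √L * C₄ := by positivity
    have : 0 < 2 * stdPdf 0 + C₃ + √L * C₄ + L := by linarith
    positivity
  refine ⟨hpos, ?_⟩
  have h := (Nat.ceil_lt_add_one (a := 1 / gridStep C₁ C₂ C₃ C₄ n) (by positivity)).le
  refine h.trans ?_
  have h2 : 2 * stdPdf 0 + C₃ + √L * C₄ + L ≤ (2 * stdPdf 0 + C₃ + C₄ + 1) * L := by nlinarith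
  calc 1 / gridStep C₁ C₂ C₃ C₄ n + 1
      = 2 * C₁ * C₂ * (2 * stdPdf 0 + C₃ + √L * C₄ + L) + 1 := by
        rw [gridStep, one_div, inv_inv]
    _ ≤ 2 * C₁ * C₂ * ((2 * stdPdf 0 + C₃ + C₄ + 1) * L) + L := by gcongr
    _ = _ := by ring

/-- The number of grid points is negligible against the effective sample size. -/
lemma tendsto_gridCard_mul_mseBound {C₁ C₂ C₃ C₄ : ℝ} (h₁ : 0 < C₁) (h₂ : 0 < C₂) (h₃ : 0 ≤ C₃)
    (h₄ : 0 < C₄) {γ₀ : ℝ} (hγ₀ : 0 < γ₀) :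
    Tendsto (fun n : ℕ => (⌈1 / gridStep C₁ C₂ C₃ C₄ n⌉₊ : ℝ) * ((mseBound γ₀ n + 1) / n))
      atTop (𝓝 0) := by
  have hlim : Tendsto (fun n : ℕ => (2 * C₁ * C₂ * (2 * stdPdf 0 + C₃ + C₄ + 1) + 1)
      * (80 / γ₀ + 328) * (Real.log (Real.log n) / √(Real.log n))) atTop (𝓝 0) := by
    have h := ((isLittleO_log_rpow_atTop (r := 1 / 2) (by norm_num)).tendsto_div_nhds_zero).comp
      tendsto_log_natCast
    have := h.const_mul ((2 * C₁ * C₂ * (2 * stdPdf 0 + C₃ + C₄ + 1) + 1) * (80 / γ₀ + 328))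
    rw [mul_zero] at this
    refine this.congr fun n => ?_
    simp [Real.sqrt_eq_rpow]
  refine squeeze_zero' ?_ ?_ hlim
  · filter_upwards with n
    have : 0 ≤ Real.log n := Real.log_natCast_nonneg n
    unfold mseBound
    positivity
  · filter_upwards [eventually_gridStep h₁ h₂ h₃ h₄, eventually_mseBound_le hγ₀] with n h h'
    refine (mul_le_mul h.2 h' ?_ ((Nat.cast_nonneg _).trans h.2)).trans_eq (by ring)
    have : 0 ≤ Real.log n := Real.log_natCast_nonneg n
    unfold mseBound
    positivity

/-! ### Integrability of the predictive loss -/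

lemma integrable_avg_abs (P : ℕ → Coord) (θ : ℕ → ℝ) (n : ℕ) :
    Integrable (fun x : Fin n → ℝ => (1 / n : ℝ) * ∑ i, |x i|) (dataLaw P θ n) := by
  refine (integrable_finsetSum _ fun i _ => ?_).const_mul _
  exact memLp_one_iff_integrable.1 (memLp_eval_dataLaw P θ i (f := fun x => |x|)
    (memLp_one_iff_integrable.2 (integrable_id_gaussianReal _ _).abs))

lemma integral_avg_abs_le {P : ℕ → Coord} {K : ℝ} (hK : ∀ i, ((P i).σp : ℝ) ≤ K) (θ : ℕ → ℝ)
    {n : ℕ} (hn : 0 < n) :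
    ∫ x : Fin n → ℝ, (1 / n : ℝ) * ∑ i, |x i| ∂(dataLaw P θ n)
      ≤ (1 / (n : ℝ)) * ∑ i ∈ Finset.range n, |θ i| + 1 + K := by
  have hn0 : (0 : ℝ) < n := by exact_mod_cast hn
  have hi : ∀ i : Fin n, Integrable (fun x : Fin n → ℝ => |x i|) (dataLaw P θ n) := fun i =>
    memLp_one_iff_integrable.1 (memLp_eval_dataLaw P θ i (f := fun x => |x|)
      (memLp_one_iff_integrable.2 (integrable_id_gaussianReal _ _).abs))
  have hone : ∀ i : Fin n, ∫ x : Fin n → ℝ, |x i| ∂(dataLaw P θ n) ≤ |θ i| + (1 + K) := fun i => by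
    rw [integral_eval_dataLaw P θ i (f := fun x => |x|) (by fun_prop)]
    set κ := gaussianReal (θ i) (P i).σp
    have hx : MemLp (fun x : ℝ => x - θ i) 2 κ :=
      (memLp_id_gaussianReal' 2 (by simp)).sub (memLp_const _)
    have hv : ∫ x, (x - θ i) ^ 2 ∂κ = (P i).σp := by
      have := variance_eq_integral (μ := κ) (X := fun x => x) (by fun_prop)
      rw [variance_fun_id_gaussianReal, integral_id_gaussianReal] at this
      exact this.symm
    calc ∫ x, |x| ∂κ ≤ ∫ x, (|θ i| + 1 + (x - θ i) ^ 2) ∂κ := by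
          refine integral_mono (integrable_id_gaussianReal _ _).abs
            ((integrable_const _).add hx.integrable_sq) fun x => ?_
          have h1 := abs_add_le (θ i) (x - θ i)
          rw [add_sub_cancel] at h1
          have h2 : |x - θ i| ≤ 1 + (x - θ i) ^ 2 := by
            rw [← sq_abs]; nlinarith [sq_nonneg (|x - θ i| - 1), sq_nonneg |x - θ i|]
          linarith
      _ = |θ i| + 1 + (P i).σp := by
          rw [integral_add (integrable_const _) hx.integrable_sq, hv]; simp
      _ ≤ _ := by linarith [hK i]
  rw [integral_const_mul, integral_finsetSum _ fun i _ => hi i, Finset.sum_range]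
  calc 1 / (n : ℝ) * ∑ i : Fin n, ∫ x : Fin n → ℝ, |x i| ∂(dataLaw P θ n)
      ≤ 1 / (n : ℝ) * ∑ i : Fin n, (|θ i| + (1 + K)) := by gcongr with i; exact hone i
    _ = _ := by
      rw [Finset.sum_add_distrib]
      simp
      field_simp
      ring

/-- Comparison with the constant choice `τ = 0`: shrinkage factors differ by at most `1`, so the
difference of losses has an integrable bound uniform in `τ`. -/
lemma integrable_avgLoss {P : ℕ → Coord} (hb : ∀ i, 0 ≤ (P i).b) (hh : ∀ i, 0 ≤ (P i).h) {A H : ℝ}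
    (hA : ∀ i, (P i).b + (P i).h ≤ A) (hσf : ∀ i, 0 < ((P i).σf : ℝ))
    (hH : ∀ i, (P i).σp / √(P i).σf * |stdQuantile (P i).ratio| ≤ H) (θ : ℕ → ℝ) (n : ℕ)
    {τ : (Fin n → ℝ) → ℝ≥0∞} (hτ : Measurable τ) :
    Integrable (fun x => avgLoss P θ n (τ x) x) (dataLaw P θ n) := by
  rcases n.eq_zero_or_pos with rfl | hn
  · simp [avgLoss]
  have hα : ∀ τ τ' : ℝ≥0∞, ∀ i, |(P i).alpha τ - (P i).alpha τ'| ≤ 1 := fun τ τ' i => by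
    have := (P i).alpha_nonneg τ; have := (P i).alpha_le_one τ
    have := (P i).alpha_nonneg τ'; have := (P i).alpha_le_one τ'
    rw [abs_le]; constructor <;> linarith
  have h0 : Integrable (fun x => avgLoss P θ n 0 x) (dataLaw P θ n) := by
    refine (integrable_finsetSum _ fun i _ => ?_).const_mul _
    exact (memLp_eval_dataLaw P θ i
      (Coord.memLp_loss_qhat (hb i) (hh i) 0 (θ i) (θ i) (P i).σp).1).integrable (by norm_num)
  have hm : Measurable fun x => avgLoss P θ n (τ x) x := by
    refine (Finset.measurable_sum _ fun i _ => ?_).const_mul _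
    refine (Coord.continuous_loss (hb i) (hh i) (θ i)).measurable.comp ?_
    have ha : Measurable fun x => (P i).alpha (τ x) := (P i).measurable_alpha.comp hτ
    unfold Coord.qhat
    fun_prop
  have hd : Integrable (fun x => avgLoss P θ n (τ x) x - avgLoss P θ n 0 x) (dataLaw P θ n) := by
    refine Integrable.mono' (((integrable_avg_abs P θ n).add (integrable_const H)).const_mul (A * 1))
      (hm.aestronglyMeasurable.sub h0.aestronglyMeasurable) (Eventually.of_forall fun x => ?_)
    exact abs_avgLoss_sub_le hb hh hA hσf hH (hα _ _) θ hn x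
  refine (hd.add h0).congr (Eventually.of_forall fun x => ?_)
  simp

/-! ### The oracle inequality for the minimizer of the risk estimate -/

/-- Up to an error with vanishing mean, the minimizer of the risk estimate over the grid does as
well as every hyperparameter, simultaneously. -/
theorem eventually_oracle_inequality {P : ℕ → Coord} {γ : ℕ → ℝ} {γ₀ C₁ C₂ C₃ C₄ B H : ℝ}
    (hP : ∀ i, (P i).Admissible γ₀ (γ i)) (hA : ∀ i, (P i).b + (P i).h ≤ C₁)
    (hB : ∀ i, ((P i).σf : ℝ) + (P i).σp ≤ B)
    (hC₂ : ∀ i, ((P i).σp : ℝ) ≤ C₂ ∧ ((P i).σp : ℝ)⁻¹ ≤ C₂)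
    (hH : ∀ i, (P i).σp / √(P i).σf * |stdQuantile (P i).ratio| ≤ H)
    (h₃ : 0 ≤ C₃) (h₄ : 0 < C₄) {τARE : (n : ℕ) → (Fin n → ℝ) → ℝ≥0∞}
    (hτ : IsAREMinimizer P γ (grid C₁ C₂ C₃ C₄) τARE) {θ : ℕ → ℝ} (hθ : BoundedMeans θ)
    {ε : ℝ} (hε : 0 < ε) :
    ∀ᶠ n in atTop, ∃ E : (Fin n → ℝ) → ℝ, Integrable E (dataLaw P θ n) ∧
      (∀ x τ, avgLoss P θ n (τARE n x) x ≤ avgLoss P θ n τ x + E x) ∧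
      ∫ x, E x ∂(dataLaw P θ n) ≤ ε := by
  have h₁ : 0 < C₁ := (add_pos (hP 0).b_pos (hP 0).h_pos).trans_le (hA 0)
  have h₂ : 0 < C₂ := (hP 0).σp_pos.trans_le (hC₂ 0).1
  have hb := fun i => (hP i).b_pos.le
  have hh := fun i => (hP i).h_pos.le
  obtain ⟨b, hbm⟩ := hθ
  rw [eventually_map] at hbm
  set s := ε / 8 with hs
  have hs0 : 0 < s := by positivity
  -- The three sources of error: bias, fluctuation summed over the grid, and discretization.
  have hlim : Tendsto (fun n : ℕ => 2 * (C₁ * √B) * biasBound γ₀ n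
      + 2 * (2 * (C₁ ^ 2 * B)) / s * ((⌈1 / gridStep C₁ C₂ C₃ C₄ n⌉₊ : ℝ) * ((mseBound γ₀ n + 1) / n))
      + C₁ * C₂ ^ 3 * (b + 1 + C₂ + H) * gridStep C₁ C₂ C₃ C₄ n) atTop (𝓝 0) := by
    simpa using (((tendsto_biasBound (hP 0).γ₀_pos).const_mul (2 * (C₁ * √B))).add
      ((tendsto_gridCard_mul_mseBound h₁ h₂ h₃ h₄ (hP 0).γ₀_pos).const_mul
        (2 * (2 * (C₁ ^ 2 * B)) / s))).add
      ((tendsto_gridStep h₁ h₂ h₃ h₄).const_mul (C₁ * C₂ ^ 3 * (b + 1 + C₂ + H)))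
  filter_upwards [hbm, hlim.eventually_le_const (show (0 : ℝ) < ε / 2 by positivity),
    eventually_gridStep h₁ h₂ h₃ h₄, eventually_ge_atTop 3] with n hbn hsmall hgrid hn
  obtain ⟨hδ, -⟩ := hgrid
  set δ := gridStep C₁ C₂ C₃ C₄ n
  set N := ⌈1 / δ⌉₊
  -- Strict inequality keeps every grid point different from `∞`.
  have hlt : ∀ j < N, (j : ℝ) * δ < 1 := fun j hj => by
    have := Nat.lt_ceil.1 hj
    rwa [lt_div_iff₀ hδ] at this
  obtain ⟨D, hDi, hD, hDint⟩ := exists_uniform_error hP hA hB θ hn N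
    (τ := fun j => gridPoint (j * δ)) (fun j hj => gridPoint_ne_top (hlt j hj)) hs0
  have havg := integrable_avg_abs P θ n
  have hE2 : Integrable (fun x : Fin n → ℝ => C₁ * (C₂ ^ 3 * δ) * ((1 / n) * ∑ i, |x i| + H))
      (dataLaw P θ n) := (havg.add (integrable_const H)).const_mul _
  -- `D` enters twice because risk estimate and loss are exchanged both at the minimizer and at the
  -- grid neighbour of `τ`; the last term pays for moving `τ` to that neighbour.
  refine ⟨fun x => 2 * D x + C₁ * (C₂ ^ 3 * δ) * ((1 / n) * ∑ i, |x i| + H),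
    (hDi.const_mul 2).add hE2, fun x τ => ?_, ?_⟩
  · obtain ⟨t, ht0, ht1, ht⟩ := Coord.exists_alpha_eq τ
    obtain ⟨k, hk, hkt⟩ := exists_nat_mul_close ht0 ht1 hδ
    obtain ⟨⟨j, hj, hjx⟩, hmin⟩ := hτ n x
    have hmin := hmin (gridPoint (k * δ)) ⟨k, hk, rfl⟩
    change τARE n x = gridPoint (j * δ) at hjx
    have hclose := abs_avgLoss_sub_le hb hh hA (fun i => (hP i).σf_pos) hH
      (τ := τ) (τ' := gridPoint (k * δ)) (κ := C₂ ^ 3 * δ) (fun i => by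
        rw [ht, (P i).alpha_gridPoint (by positivity) (hlt k hk)]
        refine ((P i).abs_alphaUnit_sub_le (hP i).σp_pos (hC₂ i).1 (hC₂ i).2 ht0 ht1
          (by positivity) (hlt k hk).le).trans ?_
        gcongr) θ (by omega) x
    have h1 := abs_le.1 (hD x j hj)
    have h2 := abs_le.1 (hD x k hk)
    have h3 := abs_le.1 hclose
    rw [hjx] at hmin ⊢
    linarith
  · have hI := integral_avg_abs_le (fun i => (hC₂ i).1) θ (by omega : 0 < n) (P := P)
    rw [integral_add (hDi.const_mul 2) hE2, integral_const_mul, integral_const_mul,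
      integral_add havg (integrable_const H), integral_const, probReal_univ, one_smul]
    have h1 : C₁ * (C₂ ^ 3 * δ) * (∫ x : Fin n → ℝ, (1 / n) * ∑ i, |x i| ∂(dataLaw P θ n) + H)
        ≤ C₁ * (C₂ ^ 3 * δ) * (b + 1 + C₂ + H) := by
      gcongr
      linarith
    have e1 : C₁ * (C₂ ^ 3 * δ) * (b + 1 + C₂ + H) = C₁ * C₂ ^ 3 * (b + 1 + C₂ + H) * δ := by ring
    have e2 : 2 * (2 * (C₁ ^ 2 * B)) / s * (N * ((mseBound γ₀ n + 1) / n))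
        = 2 * (N * (2 * (C₁ ^ 2 * B) * (mseBound γ₀ n + 1) / n) / s) := by ring
    rw [e2] at hsmall
    linarith

end

end CheckLoss

/-! ### Both claims from the oracle inequality -/

theorem mainTheorem6
    (P : ℕ → CheckLoss.Coord)
    (hA1 : CheckLoss.BoundedWeights P)
    (hA3 : CheckLoss.SufficientHistory P)
    (γ : ℕ → ℝ) (hγ : CheckLoss.AdmissibleThresholds P γ)
    (C₁ C₂ C₃ C₄ : ℝ) (hC : CheckLoss.GridConstants P C₁ C₂ C₃ C₄)
    (τARE : (n : ℕ) → (Fin n → ℝ) → ℝ≥0∞)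
    (hτARE_meas : ∀ n, Measurable (τARE n))
    (hτARE : CheckLoss.IsAREMinimizer P γ (CheckLoss.grid C₁ C₂ C₃ C₄) τARE)
    (θ : ℕ → ℝ) (hA2 : CheckLoss.BoundedMeans θ)
    (τhat : (n : ℕ) → (Fin n → ℝ) → ℝ≥0∞)
    (hτhat_meas : ∀ n, Measurable (τhat n)) :
    (∀ ε : ℝ, 0 < ε →
      Tendsto (fun n => CheckLoss.dataLaw P θ n
        {x | CheckLoss.avgLoss P θ n (τhat n x) x + ε ≤ CheckLoss.avgLoss P θ n (τARE n x) x})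
        atTop (𝓝 0)) ∧
    (∀ n, Integrable (fun x => CheckLoss.avgLoss P θ n (τARE n x) x) (CheckLoss.dataLaw P θ n) ∧
      Integrable (fun x => CheckLoss.avgLoss P θ n (τhat n x) x) (CheckLoss.dataLaw P θ n)) ∧
    limsup (fun n =>
      ((CheckLoss.risk P θ n (τARE n) - CheckLoss.risk P θ n (τhat n) : ℝ) : EReal)) atTop ≤ 0 := by
  obtain ⟨γ₀, hγ₀, hγ₀le⟩ := hγ.1
  obtain ⟨hσf, -, ⟨F, hF⟩, lo, hlo, hσp⟩ := hA3
  obtain ⟨hC₁, hC₂, hC₃, hC₄⟩ := hC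
  have hP : ∀ i, (P i).Admissible γ₀ (γ i) := fun i =>
    { b_pos := (hA1.1 i).1
      h_pos := (hA1.1 i).2
      σp_pos := hlo.trans_le (hσp i)
      σf_pos := by exact_mod_cast hσf i
      γ₀_pos := hγ₀
      γ₀_le := hγ₀le i
      γ_lt := hγ.2 i }
  have h₃ : 0 ≤ C₃ := le_trans (by positivity) (hC₃ 0 0)
  have hB : ∀ i, ((P i).σf : ℝ) + (P i).σp ≤ F + C₂ := fun i => add_le_add (hF i) (hC₂ i).1
  -- Write `σp/√σf = (σp/σf) √σf`: the first factor is covered by `C₃`, the second by the upper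
  -- bound `F` on the future variances.
  have hH : ∀ i, (P i).σp / √(P i).σf * |CheckLoss.stdQuantile (P i).ratio| ≤ C₃ * √F := fun i => by
    have h := (hP i).σf_pos
    have e : ((P i).σp : ℝ) / √(P i).σf = (P i).σp / (P i).σf * √(P i).σf := by
      rw [div_mul_eq_mul_div, div_eq_div_iff (Real.sqrt_pos.2 h).ne' h.ne', mul_assoc,
        Real.mul_self_sqrt h.le]
    rw [e, mul_right_comm]
    exact mul_le_mul (hC₃ i i) (Real.sqrt_le_sqrt (hF i)) (Real.sqrt_nonneg _) h₃
  have hint : ∀ n (τ : (Fin n → ℝ) → ℝ≥0∞), Measurable τ →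
      Integrable (fun x => CheckLoss.avgLoss P θ n (τ x) x) (CheckLoss.dataLaw P θ n) :=
    fun n τ hτ => CheckLoss.integrable_avgLoss (fun i => (hP i).b_pos.le) (fun i => (hP i).h_pos.le)
      hC₁ (fun i => (hP i).σf_pos) hH θ n hτ
  have horacle := fun (ε : ℝ) (hε : 0 < ε) => CheckLoss.eventually_oracle_inequality hP hC₁ hB hC₂
    hH h₃ hC₄ hτARE hA2 hε
  refine ⟨fun ε hε => ?_, fun n => ⟨hint n _ (hτARE_meas n), hint n _ (hτhat_meas n)⟩, ?_⟩
  · rw [ENNReal.tendsto_nhds_zero]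
    intro η hη
    obtain ⟨r, hr0, hrη⟩ := ENNReal.lt_iff_exists_nnreal_btwn.1 hη
    have hr0 : (0 : ℝ) < r := by exact_mod_cast hr0
    -- A mean of at most `ε r` is what Markov's inequality at level `ε` needs to give probability at
    -- most `r`.
    filter_upwards [horacle (ε * r) (by positivity)] with n ⟨E, hEi, hE, hEint⟩
    -- Comparing the minimizer with itself shows that the error is nonnegative.
    have hE0 : ∀ x, 0 ≤ E x := fun x => by linarith [hE x (τARE n x)]
    have hsub : {x | CheckLoss.avgLoss P θ n (τhat n x) x + ε
        ≤ CheckLoss.avgLoss P θ n (τARE n x) x} ⊆ {x | ε ≤ E x} := fun x hx => by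
      have := hE x (τhat n x)
      rw [Set.mem_ofPred_eq] at hx ⊢
      linarith
    refine (measure_mono hsub).trans (le_trans ?_ hrη.le)
    have hmarkov := mul_meas_ge_le_integral_of_nonneg (Eventually.of_forall hE0) hEi ε
    rw [← ofReal_measureReal, ← ENNReal.ofReal_coe_nnreal]
    refine ENNReal.ofReal_le_ofReal ?_
    have : ε * (CheckLoss.dataLaw P θ n).real {x | ε ≤ E x} ≤ ε * r := hmarkov.trans hEint
    exact le_of_mul_le_mul_left this hε
  · refine EReal.le_of_forall_lt_iff_le.1 fun ε hε => ?_
    have hε : 0 < ε := by exact_mod_cast hε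
    refine limsup_le_of_le (by isBoundedDefault) ?_
    filter_upwards [horacle ε hε] with n ⟨E, hEi, hE, hEint⟩
    have h1 := hint n _ (hτARE_meas n)
    have h2 := hint n _ (hτhat_meas n)
    rw [EReal.coe_le_coe_iff, CheckLoss.risk, CheckLoss.risk, ← integral_sub h1 h2]
    refine (integral_mono (h1.sub h2) hEi fun x => ?_).trans hEint
    have := hE x (τhat n x)
    simp only [Pi.sub_apply]
    linarith
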